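/- Let $\Theta$ be a compact metric space, $T:\Theta\to\Theta$ a homeomorphism and $\mu$ a $T$-ergodic Borel probability measure on $\Theta$ with $\operatorname{supp}\mu=\Theta$. Let $m\ge 1$, let $C\in \mathrm{GL}(m,\mathbb C)$, and let $f$ be a continuous map from $\Theta$ to the Hermitian $m\times m$ matrices over $\mathbb C$. For $\theta\in\Theta$ let $H_\theta$ be the bounded self-adjoint operator on $\ell^2(\mathbb Z,\mathbb C^m)$ given by $$(H_\theta u)_n=C^*u_{n-1}+f(T^n\theta)\,u_n+C\,u_{n+1}.$$ There is a compact set $\Sigma_\mu\subseteq\mathbb R$ (the almost sure spectrum) with $\sigma(H_\theta)=\Sigma_\mu$ for $\mu$-a.e. $\theta$. Let $(e_i)_{i=1}^m$ be the standard basis of $\mathbb C^m$ and let $\delta_{0,i}\in\ell^2(\mathbb Z,\mathbb C^m)$ be equal to $e_i$ at the site $0$ and to $0$ at all other sites. The density of states measure $k_\mu$ is the Borel measure on $\mathbb R$ with $$\int_{\mathbb R} g\,dk_\mu=\int_\Theta\frac1m\sum_{i=1}^m\langle\delta_{0,i},g(H_\theta)\delta_{0,i}\rangle\,d\mu(\theta)$$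 for all bounded Borel functions $g$, and the integrated density of states is $\mathcal N_\mu(E)=k_\mu((-\infty,E])$. Let $X=\Theta\times[0,1]/((\theta,1)\sim(T\theta,0))$ be the suspension, with the flow $\overline T^t[\theta,s]=[\theta,s+t]$ (where $[\theta,r]:=[T^{\lfloor r\rfloor}\theta,r-\lfloor r\rfloor]$ for $r\in\mathbb R$) and the measure $\int_X h\,d\overline\mu=\int_\Theta\int_0^1 h([\theta,t])\,dt\,d\mu(\theta)$. Let $C^\sharp(X,\mathbb T)$ be the set of homotopy classes of continuous maps $X\to\mathbb T=\mathbb R/\mathbb Z$. The Schwartzman group $\mathfrak A(\Theta,T,\mu)\subseteq\mathbb R$ is the range of the Schwartzman homomorphism $$C^\sharp(X,\mathbb T)\to\mathbb R,\qquad [\phi]\mapsto\lim_{t\to\infty}\frac{\tilde\phi_x(t)}{t}\quad\text{for }\overline\mu\text{-a.e. }x\in X,$$ where $\tilde\phi_x:\mathbb R\to\mathbb R$ is any continuous lift of $t\mapsto\phi(\overline T^tx)$. Then for every $E\in\mathbb R\setminus\Sigma_\mu$, $$m\,\mathcal N_\mu(E)\in\mathfrak A(\Theta,T,\mu)\cap[0,m].$$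 -/

import Mathlib

open MeasureTheory Filter Topology Set
open scoped ENNReal CompactlySupported

noncomputable section

namespace GapLabel

/-! ### Generalized Schrödinger operators -/

/-- The Hilbert space `ℓ²(ℤ, ℂᵐ)`. -/
abbrev L2 (m : ℕ) : Type := lp (fun _ : ℤ => EuclideanSpace ℂ (Fin m)) 2

/-- The action of an `m × m` matrix on `ℂᵐ`. -/
abbrev act {m : ℕ} (A : Matrix (Fin m) (Fin m) ℂ) :
    EuclideanSpace ℂ (Fin m) →L[ℂ] EuclideanSpace ℂ (Fin m) :=
  Matrix.toEuclideanCLM (𝕜 := ℂ) A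

theorem memlp_comp_equiv {m : ℕ} {u : ℤ → EuclideanSpace ℂ (Fin m)} (hu : Memℓp u 2)
    (e : ℤ ≃ ℤ) : Memℓp (fun n => u (e n)) 2 := by
  rw [memℓp_gen_iff (by norm_num)] at hu ⊢
  exact hu.comp_injective e.injective

theorem memlp_act {m : ℕ} {u : ℤ → EuclideanSpace ℂ (Fin m)} (hu : Memℓp u 2)
    (B : ℤ → Matrix (Fin m) (Fin m) ℂ) (hB : ∃ K : ℝ, ∀ n, ‖act (B n)‖ ≤ K) :
    Memℓp (fun n => act (B n) (u n)) 2 := by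
  obtain ⟨K, hK⟩ := hB
  rw [memℓp_gen_iff (by norm_num)] at hu ⊢
  refine Summable.of_nonneg_of_le (fun n => by positivity) (fun n => ?_)
    (hu.mul_left (K ^ (2 : ℝ≥0∞).toReal))
  have h0 : 0 ≤ K := (norm_nonneg _).trans (hK n)
  rw [← Real.mul_rpow h0 (norm_nonneg _)]
  refine Real.rpow_le_rpow (norm_nonneg _) ?_ (by norm_num)
  exact ((act (B n)).le_opNorm (u n)).trans
    (mul_le_mul_of_nonneg_right (hK n) (norm_nonneg _))

/-- The linear map `(H u)ₙ = C* uₙ₋₁ + B(n) uₙ + C uₙ₊₁` on `ℓ²(ℤ, ℂᵐ)`. -/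
def blockJacobiLin {m : ℕ} (C : Matrix (Fin m) (Fin m) ℂ) (B : ℤ → Matrix (Fin m) (Fin m) ℂ)
    (hB : ∃ K : ℝ, ∀ n, ‖act (B n)‖ ≤ K) : L2 m →ₗ[ℂ] L2 m where
  toFun u := ⟨fun n => act C.conjTranspose (u (n - 1)) + act (B n) (u n) + act C (u (n + 1)),
    ((memlp_act (memlp_comp_equiv u.2 (Equiv.subRight 1)) (fun _ => C.conjTranspose)
      ⟨_, fun _ => le_rfl⟩).add (memlp_act u.2 B hB)).add
      (memlp_act (memlp_comp_equiv u.2 (Equiv.addRight 1)) (fun _ => C) ⟨_, fun _ => le_rfl⟩)⟩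
  map_add' u v := by
    ext1
    funext n
    simp only [lp.coeFn_add, Pi.add_apply, map_add]
    abel
  map_smul' c u := by
    ext1
    funext n
    simp only [lp.coeFn_smul, Pi.smul_apply, map_smul, smul_add, RingHom.id_apply]

/-- The bounded operator `(H u)ₙ = C* uₙ₋₁ + B(n) uₙ + C uₙ₊₁` on `ℓ²(ℤ, ℂᵐ)`;
boundedness follows from the closed graph theorem. -/
def blockJacobi {m : ℕ} (C : Matrix (Fin m) (Fin m) ℂ) (B : ℤ → Matrix (Fin m) (Fin m) ℂ)
    (hB : ∃ K : ℝ, ∀ n, ‖act (B n)‖ ≤ K) : L2 m →L[ℂ] L2 m :=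
  ContinuousLinearMap.ofSeqClosedGraph (g := blockJacobiLin C B hB) (by
    intro u x y hx hy
    have ev : ∀ n : ℤ, Continuous fun w : L2 m => w n := fun n =>
      (lp.evalCLM ℂ (fun _ : ℤ => EuclideanSpace ℂ (Fin m)) (2 : ℝ≥0∞) n).continuous
    have hc : ∀ n : ℤ, Continuous fun w : L2 m => (blockJacobiLin C B hB w) n := fun n =>
      (((act C.conjTranspose).continuous.comp (ev (n - 1))).add
        ((act (B n)).continuous.comp (ev n))).add ((act C).continuous.comp (ev (n + 1)))
    ext1
    funext n
    exact tendsto_nhds_unique (((ev n).tendsto y).comp hy) (((hc n).tendsto x).comp hx))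

theorem blockJacobi_apply {m : ℕ} (C : Matrix (Fin m) (Fin m) ℂ)
    (B : ℤ → Matrix (Fin m) (Fin m) ℂ) (hB : ∃ K : ℝ, ∀ n, ‖act (B n)‖ ≤ K)
    (u : L2 m) (n : ℤ) :
    (blockJacobi C B hB u) n
      = act C.conjTranspose (u (n - 1)) + act (B n) (u n) + act C (u (n + 1)) := rfl

theorem bounded_potential {Θ : Type*} [TopologicalSpace Θ] [CompactSpace Θ] {m : ℕ}
    (T : Θ ≃ₜ Θ) (f : C(Θ, Matrix (Fin m) (Fin m) ℂ)) (θ : Θ) :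
    ∃ K : ℝ, ∀ n : ℤ, ‖act (f ((T ^ n) θ))‖ ≤ K := by
  have hl : Continuous fun A : Matrix (Fin m) (Fin m) ℂ => act A :=
    (Matrix.toEuclideanCLM (n := Fin m) (𝕜 := ℂ)).toAlgEquiv.toLinearMap.continuous_of_finiteDimensional
  obtain ⟨K, hK⟩ := (isCompact_range (hl.comp f.continuous).norm).bddAbove
  exact ⟨K, fun n => hK ⟨(T ^ n) θ, rfl⟩⟩

/-- The operator `H_θ` with `B_θ(n) = f(Tⁿ θ)`. -/
def schrodinger {Θ : Type*} [TopologicalSpace Θ] [CompactSpace Θ] {m : ℕ}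
    (T : Θ ≃ₜ Θ) (C : Matrix (Fin m) (Fin m) ℂ) (f : C(Θ, Matrix (Fin m) (Fin m) ℂ)) (θ : Θ) :
    L2 m →L[ℂ] L2 m :=
  blockJacobi C (fun n : ℤ => f ((T ^ n) θ)) (bounded_potential T f θ)

/-- `S ⊆ ℝ` is the almost sure spectrum of `{H_θ}`: it is compact, and
`σ(H_θ) = S` (as subsets of `ℂ`) for `μ`-almost every `θ`. -/
def IsAlmostSureSpectrum {Θ : Type*} [TopologicalSpace Θ] [CompactSpace Θ] [MeasurableSpace Θ]
    (μ : Measure Θ) {m : ℕ} (T : Θ ≃ₜ Θ) (C : Matrix (Fin m) (Fin m) ℂ)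
    (f : C(Θ, Matrix (Fin m) (Fin m) ℂ)) (S : Set ℝ) : Prop :=
  IsCompact S ∧ ∀ᵐ θ ∂μ, spectrum ℂ (schrodinger T C f θ) = (fun x : ℝ => (x : ℂ)) '' S

/-! ### Integrated density of states -/

/-- The positive functional `g ↦ ⟨v, g(A) v⟩` on `C_c(ℝ, ℝ)`, for a bounded self-adjoint `A`. -/
def spectralFunctional {E : Type*} [NormedAddCommGroup E] [InnerProductSpace ℂ E]
    [CompleteSpace E] (A : E →L[ℂ] E) (v : E) : C_c(ℝ, ℝ) →ₚ[ℝ] ℝ :=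
  PositiveLinearMap.mk₀
    { toFun := fun g => (inner ℂ v (cfc (fun x : ℝ => g x) A v)).re
      map_add' := fun g h => by
        have : cfc (fun x : ℝ => (g + h) x) A = cfc (fun x : ℝ => g x) A + cfc (fun x : ℝ => h x) A :=
          cfc_add (R := ℝ) (a := A) (fun x => g x) (fun x => h x) g.continuous.continuousOn
            h.continuous.continuousOn
        rw [this, add_apply, inner_add_right, Complex.add_re]
      map_smul' := fun c g => by
        have : cfc (fun x : ℝ => (c • g) x) A = c • cfc (fun x : ℝ => g x) A :=
          cfc_smul (R := ℝ) (a := A) c (fun x => g x) g.continuous.continuousOn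
        rw [this, smul_apply, ← Complex.coe_smul, inner_smul_right]
        simp }
    (fun g hg => by
      have h0 : 0 ≤ cfc (fun x : ℝ => g x) A := cfc_nonneg (fun x _ => hg x)
      have h1 := ((ContinuousLinearMap.nonneg_iff_isPositive _).1 h0).inner_nonneg_right v
      exact (Complex.le_def.1 h1).1)

/-- The spectral measure of the bounded self-adjoint operator `A` at the vector `v`: the Borel
measure on `ℝ` with `∫ g = ⟨v, g(A) v⟩` for all `g ∈ C_c(ℝ)`, and therefore for all bounded
Borel functions `g`. -/
def spectralMeasure {E : Type*} [NormedAddCommGroup E] [InnerProductSpace ℂ E]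
    [CompleteSpace E] (A : E →L[ℂ] E) (v : E) : Measure ℝ :=
  RealRMK.rieszMeasure (spectralFunctional A v)

theorem integral_spectralMeasure {E : Type*} [NormedAddCommGroup E] [InnerProductSpace ℂ E]
    [CompleteSpace E] (A : E →L[ℂ] E) (v : E) (g : C_c(ℝ, ℝ)) :
    ∫ x, g x ∂(spectralMeasure A v) = (inner ℂ v (cfc (fun x : ℝ => g x) A v)).re :=
  RealRMK.integral_rieszMeasure (spectralFunctional A v) g

/-- The vector `δ_{n,i} ∈ ℓ²(ℤ, ℂᵐ)`. -/
def delta {m : ℕ} (n : ℤ) (i : Fin m) : L2 m :=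
  lp.single 2 n (EuclideanSpace.single i (1 : ℂ))

/-- The density of states measure `k` of the family `{H_θ}`:
`∫ g dk = ∫ (1/m) ∑ᵢ ⟨δ_{0,i}, g(H_θ) δ_{0,i}⟩ dμ(θ)`. That is, `k` is the `μ`-average of the
measures `(1/m) ∑ᵢ (spectral measure of H_θ at δ_{0,i})`. -/
def densityOfStates {Θ : Type*} [TopologicalSpace Θ] [CompactSpace Θ] [MeasurableSpace Θ]
    (μ : Measure Θ) {m : ℕ} (T : Θ ≃ₜ Θ) (C : Matrix (Fin m) (Fin m) ℂ)
    (f : C(Θ, Matrix (Fin m) (Fin m) ℂ)) : Measure ℝ :=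
  μ.bind fun θ => (m : ℝ≥0∞)⁻¹ • ∑ i : Fin m, spectralMeasure (schrodinger T C f θ) (delta 0 i)

/-- The integrated density of states `N(E) = k((-∞, E])`. -/
def ids {Θ : Type*} [TopologicalSpace Θ] [CompactSpace Θ] [MeasurableSpace Θ]
    (μ : Measure Θ) {m : ℕ} (T : Θ ≃ₜ Θ) (C : Matrix (Fin m) (Fin m) ℂ)
    (f : C(Θ, Matrix (Fin m) (Fin m) ℂ)) (E : ℝ) : ℝ :=
  (densityOfStates μ T C f).real (Iic E)

/-! ### The suspension flow -/

/-- The relation `(θ, 1) ~ (Tθ, 0)` on `Θ × [0,1]`. -/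
def SuspRel {Θ : Type*} [TopologicalSpace Θ] (T : Θ ≃ₜ Θ) (p q : Θ × unitInterval) : Prop :=
  p.2 = 1 ∧ q = (T p.1, 0)

/-- The suspension `X = Θ × [0,1] / ((θ,1) ~ (Tθ,0))`. -/
def Suspension {Θ : Type*} [TopologicalSpace Θ] (T : Θ ≃ₜ Θ) : Type _ := Quot (SuspRel T)

section Susp

variable {Θ : Type*} [TopologicalSpace Θ] (T : Θ ≃ₜ Θ)

instance : TopologicalSpace (Suspension T) :=
  inferInstanceAs (TopologicalSpace (Quot (SuspRel T)))

instance [CompactSpace Θ] : CompactSpace (Suspension T) :=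
  inferInstanceAs (CompactSpace (Quot (SuspRel T)))

instance : MeasurableSpace (Suspension T) := borel _

instance : BorelSpace (Suspension T) := ⟨rfl⟩

/-- The class `[θ, s]`. -/
def Suspension.mk (p : Θ × unitInterval) : Suspension T := Quot.mk (SuspRel T) p

theorem Suspension.continuous_mk : Continuous (Suspension.mk T) := continuous_quot_mk

/-- The class `[θ, r]` for an arbitrary real `r`, namely `[T^⌊r⌋ θ, r - ⌊r⌋]`. -/
def Suspension.mkReal (θ : Θ) (r : ℝ) : Suspension T :=
  Suspension.mk T ((T ^ ⌊r⌋) θ, ⟨Int.fract r, Int.fract_nonneg r, (Int.fract_lt_one r).le⟩)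

/-- The suspension flow, `[θ, s] ↦ [θ, s + t]`. -/
def Suspension.flow (t : ℝ) : Suspension T → Suspension T :=
  Quot.lift (fun p => Suspension.mkReal T p.1 ((p.2 : ℝ) + t)) (by
    rintro ⟨θ, s⟩ ⟨η, r⟩ ⟨h1, h2⟩
    obtain ⟨rfl, rfl⟩ := Prod.ext_iff.1 h2
    simp only at h1
    subst h1
    have e1 : ⌊((1 : unitInterval) : ℝ) + t⌋ = ⌊t⌋ + 1 := by
      rw [Set.Icc.coe_one, add_comm, Int.floor_add_one]
    have e2 : Int.fract (((1 : unitInterval) : ℝ) + t) = Int.fract t := by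
      rw [Set.Icc.coe_one, add_comm, Int.fract_add_one]
    simp only [Suspension.mkReal, e1, e2, Set.Icc.coe_zero, zero_add, zpow_add, zpow_one,
      Homeomorph.mul_apply])

theorem Suspension.continuous_mkReal (θ : Θ) : Continuous (Suspension.mkReal T θ) := by
  have hlf : LocallyFinite fun n : ℤ => Icc (n : ℝ) (n + 1) := by
    intro x
    refine ⟨Ioo (x - 1) (x + 1), Ioo_mem_nhds (by linarith) (by linarith), ?_⟩
    refine (Set.finite_Icc (⌊x⌋ - 2) (⌊x⌋ + 2)).subset ?_
    rintro n ⟨y, ⟨h1, h2⟩, h3, h4⟩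
    have a1 := Int.floor_le x
    have a2 := Int.lt_floor_add_one x
    constructor
    · have : ((⌊x⌋ - 2 : ℤ) : ℝ) ≤ (n : ℝ) := by push_cast; linarith
      exact_mod_cast this
    · have : (n : ℝ) ≤ ((⌊x⌋ + 2 : ℤ) : ℝ) := by push_cast; linarith
      exact_mod_cast this
  refine hlf.continuous ?_ (fun n => isClosed_Icc) (fun n => ?_)
  · exact eq_univ_of_forall fun x =>
      mem_iUnion.2 ⟨⌊x⌋, Int.floor_le x, (Int.lt_floor_add_one x).le⟩
  · have hc : Continuous fun r : ℝ =>
        Suspension.mk T ((T ^ n) θ, Set.projIcc (0 : ℝ) 1 zero_le_one (r - n)) :=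
      (Suspension.continuous_mk T).comp
        (continuous_const.prodMk (continuous_projIcc.comp (continuous_id.sub continuous_const)))
    refine hc.continuousOn.congr ?_
    rintro r ⟨h1, h2⟩
    rcases h2.lt_or_eq with h | h
    · have e : ⌊r⌋ = n := Int.floor_eq_iff.2 ⟨h1, h⟩
      have hm : r - n ∈ Icc (0 : ℝ) 1 := ⟨by linarith, by linarith⟩
      simp only [Suspension.mkReal, Set.projIcc_of_mem zero_le_one hm, Int.fract, e]
    · have e : ⌊r⌋ = n + 1 := by rw [h]; exact_mod_cast Int.floor_intCast (R := ℝ) (n + 1)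
      have hf : Int.fract r = 0 := by rw [Int.fract, e, h]; push_cast; ring
      have hp : Set.projIcc (0 : ℝ) 1 zero_le_one (r - n) = (1 : unitInterval) := by
        rw [h]; simp
      simp only [Suspension.mkReal, e, hf, hp]
      refine (Quot.sound ⟨rfl, ?_⟩).symm
      simp only [add_comm n 1, zpow_add, zpow_one, Homeomorph.mul_apply]
      rfl

theorem Suspension.continuous_flow_left (x : Suspension T) :
    Continuous fun t : ℝ => Suspension.flow T t x := by
  induction x using Quot.ind with
  | mk p => exact (Suspension.continuous_mkReal T p.1).comp (continuous_const.add continuous_id)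

/-- The measure on the suspension, `∫ f dμ̄ = ∫_Θ ∫₀¹ f([θ,t]) dt dμ(θ)`. -/
def Suspension.measure [MeasurableSpace Θ] (μ : Measure Θ) : Measure (Suspension T) :=
  (μ.prod (volume : Measure unitInterval)).map (Suspension.mk T)

/-! ### The Schwartzman group -/

/-- For `φ : X → 𝕋 = ℝ/ℤ`: for `μ̄`-a.e. `x`, a lift `φ̃ₓ : ℝ → ℝ` of `t ↦ φ(T̄ᵗ x)` satisfies
`φ̃ₓ(t)/t → a` as `t → ∞`. (Two lifts differ by a constant integer, so that the choice of the
lift does not matter.) -/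
def HasMeanWinding [MeasurableSpace Θ] (μ : Measure Θ) (φ : C(Suspension T, UnitAddCircle))
    (a : ℝ) : Prop :=
  ∀ᵐ x ∂(Suspension.measure T μ), ∃ l : C(ℝ, ℝ),
    (∀ t, (l t : UnitAddCircle) = φ (Suspension.flow T t x)) ∧
      Tendsto (fun t => l t / t) atTop (𝓝 a)

theorem HasMeanWinding.of_homotopic [CompactSpace Θ] [MeasurableSpace Θ] {μ : Measure Θ}
    {φ ψ : C(Suspension T, UnitAddCircle)} {a : ℝ} (h : HasMeanWinding T μ φ a)
    (hφψ : φ.Homotopic ψ) : HasMeanWinding T μ ψ a := by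
  obtain ⟨F⟩ := hφψ
  let D : C(unitInterval × Suspension T, UnitAddCircle) :=
    ⟨fun p => F p - φ p.2, F.continuous.sub (φ.continuous.comp continuous_snd)⟩
  let L := (AddCircle.isCoveringMap_coe (1 : ℝ)).liftHomotopy D (0 : C(Suspension T, ℝ))
    (fun x => by simp [D])
  have hL : ∀ p, ((L p : ℝ) : UnitAddCircle) = F p - φ p.2 := fun p =>
    congrFun ((AddCircle.isCoveringMap_coe (1 : ℝ)).liftHomotopy_lifts D _ _) p
  let d : C(Suspension T, ℝ) := ⟨fun x => L (1, x), by fun_prop⟩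
  have hd : ∀ x, ((d x : ℝ) : UnitAddCircle) = ψ x - φ x := fun x => by
    have := hL (1, x)
    simpa [d] using this
  obtain ⟨K, hK⟩ := (isCompact_range d.continuous.norm).bddAbove
  filter_upwards [h] with x hx
  obtain ⟨l, hl, hlim⟩ := hx
  refine ⟨l + d.comp ⟨_, Suspension.continuous_flow_left T x⟩, fun t => ?_, ?_⟩
  · simp [hl, hd]
  · have h0 : Tendsto (fun t : ℝ => d (Suspension.flow T t x) / t) atTop (𝓝 0) := by
      refine squeeze_zero_norm' ?_ (tendsto_id.const_div_atTop K)
      filter_upwards [eventually_gt_atTop 0] with t ht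
      rw [norm_div, Real.norm_of_nonneg ht.le]
      exact div_le_div_of_nonneg_right (hK ⟨_, rfl⟩) ht.le
    simpa [add_div] using hlim.add h0

/-- Homotopy of maps `X → 𝕋`. -/
def homotopySetoid : Setoid C(Suspension T, UnitAddCircle) :=
  ⟨ContinuousMap.Homotopic, ContinuousMap.Homotopic.equivalence⟩

/-- The set `C♯(X, 𝕋)` of homotopy classes of continuous maps `X → 𝕋`. -/
def HomotopyClasses : Type _ := Quotient (homotopySetoid T)

/-- `IsSchwartzmanValue T μ c a` means `𝔄_μ̄(c) = a` for the Schwartzman homomorphism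
`𝔄_μ̄ : C♯(X, 𝕋) → ℝ`, that is, `HasMeanWinding T μ φ a` for every `φ` in the class `c`. -/
def IsSchwartzmanValue [CompactSpace Θ] [MeasurableSpace Θ] (μ : Measure Θ)
    (c : HomotopyClasses T) (a : ℝ) : Prop :=
  Quotient.lift (s := homotopySetoid T) (fun φ => HasMeanWinding T μ φ a)
    (fun _ _ h => propext ⟨fun k => k.of_homotopic T h,
      fun k => k.of_homotopic T (ContinuousMap.Homotopic.symm h)⟩) c

/-- The Schwartzman group `𝔄(Θ,T,μ)`: the range of the Schwartzman homomorphism. -/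
def schwartzmanGroup [CompactSpace Θ] [MeasurableSpace Θ] (μ : Measure Θ) : AddSubgroup ℝ where
  carrier := {a | ∃ c : HomotopyClasses T, IsSchwartzmanValue T μ c a}
  zero_mem' := ⟨Quotient.mk (homotopySetoid T) 0,
    Eventually.of_forall fun x => ⟨0, fun t => by simp, by simp⟩⟩
  add_mem' := by
    rintro a b ⟨c, hc⟩ ⟨c', hc'⟩
    induction c using Quotient.ind with | _ φ
    induction c' using Quotient.ind with | _ ψ
    refine ⟨Quotient.mk (homotopySetoid T) (φ + ψ), ?_⟩
    change HasMeanWinding T μ (φ + ψ) (a + b)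
    filter_upwards [hc, hc'] with x ⟨l, hl, hla⟩ ⟨k, hk, hkb⟩
    exact ⟨l + k, fun t => by simp [hl, hk], by simpa [add_div] using hla.add hkb⟩
  neg_mem' := by
    rintro a ⟨c, hc⟩
    induction c using Quotient.ind with | _ φ
    refine ⟨Quotient.mk (homotopySetoid T) (-φ), ?_⟩
    change HasMeanWinding T μ (-φ) (-a)
    filter_upwards [hc] with x ⟨l, hl, hla⟩
    exact ⟨-l, fun t => by simp [hl], by simpa [neg_div] using hla.neg⟩

end Susp

end GapLabel

end

/-! Let `E` lie in a gap. The support condition makes the gap uniform in `θ`, so there is one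
continuous `g` that equals the indicator of `(-∞, E]` on every spectrum. Then `P_θ = g(H_θ)` is a
projection with entries continuous in `θ`, and `m N(E)` is the mean of `ρ_0(θ)`, where `ρ_n` is the
trace of the `n`-th diagonal block of `P_θ`. This mean has to be realised as a winding number.

If `φ : Θ → ℝ/ℤ` and `c : Θ → ℝ` are continuous with `φ ∘ T = φ + c`, then `φ(θ) + s c(θ)` descends
to the suspension. By Birkhoff's theorem its mean winding is `∫ c dμ`
(`integral_mem_schwartzmanGroup`). The function `φ` is obtained as the phase of a determinant. Take
a cutoff `q` falling linearly from `1` at `0` to `0` at `L`, let `M` be multiplication by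
`e^{2πiq}`, and set `w_L(θ) = det(1 + (M - 1) P_θ)`. Since `q` is integer valued off a finite
window, this is a finite determinant. For large `L` the phases vary slowly, so `M` nearly commutes
with `H_θ`, hence with `P_θ`; then `1 + (M - 1) P_θ` is bounded below and `w_L` has no zeros.

Moving `q` along a path with velocity `d` changes `log w` at the rate `2πi ∑ d_n ρ_n`, up to a small
multiple of `∑ |d_n|` (`twistDet_ratio`). By covariance `w_L(Tθ)` is the determinant for the shifted
cutoff. Hence the phase of `w_L ∘ T / w_L` is `A_L + e_L` with `A_L = ∑ (q(n-1) - q(n)) ρ_n` and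
`e_L` uniformly small; the coefficients telescope to `1`, so `∫ A_L = m N(E)`.

This puts `m N(E) + ∫ e_L` in the group, and the group need not be closed. The error is removed by
comparing consecutive lengths (`mem_schwartzmanGroup_of_asymptotic`). The phase of `w_{L+1} / w_L`
is likewise `G_L + e'_L`, with `G_L ∘ T - G_L = A_{L+1} - A_L`. Therefore `e_{L+1} - e_L` and `e'_L
∘ T - e'_L` agree modulo integers, and, being small, agree exactly. So `∫ e_L` is independent of
`L`; as it tends to `0`, it vanishes. -/

noncomputable section

namespace GapLabel

/-! ### The pointwise ergodic theorem for bounded functions -/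

section Birkhoff

variable {Ω : Type*} {T : Ω → Ω}

/-- The maximum of the first `n + 1` Birkhoff sums `∑_{k ≤ j} f (T^k x)`, `0 ≤ j ≤ n`. -/
def birkhoffMax (T : Ω → Ω) (f : Ω → ℝ) : ℕ → Ω → ℝ
  | 0 => f
  | n + 1 => fun x => f x + max 0 (birkhoffMax T f n (T x))

theorem birkhoffMax_le_succ (f : Ω → ℝ) (n : ℕ) (x : Ω) :
    birkhoffMax T f n x ≤ birkhoffMax T f (n + 1) x := by
  induction n generalizing x with
  | zero => simp [birkhoffMax]
  | succ n ih => exact add_le_add le_rfl (max_le_max le_rfl (ih (T x)))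

theorem birkhoffMax_mono (f : Ω → ℝ) (x : Ω) : Monotone fun n => birkhoffMax T f n x :=
  monotone_nat_of_le_succ fun n => birkhoffMax_le_succ f n x

theorem birkhoffSum_le_birkhoffMax (f : Ω → ℝ) (n : ℕ) (x : Ω) :
    birkhoffSum T f (n + 1) x ≤ birkhoffMax T f n x := by
  induction n generalizing x with
  | zero => simp [birkhoffMax]
  | succ n ih =>
    rw [birkhoffSum_succ']
    exact add_le_add le_rfl ((ih (T x)).trans (le_max_right _ _))

theorem measurable_birkhoffMax [MeasurableSpace Ω] {f : Ω → ℝ} (hT : Measurable T) (hf : Measurable f) (n : ℕ) :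
    Measurable (birkhoffMax T f n) := by
  induction n with
  | zero => exact hf
  | succ n ih => exact hf.add (measurable_const.max (ih.comp hT))

theorem abs_birkhoffMax_le {f : Ω → ℝ} {K : ℝ} (hK : ∀ x, |f x| ≤ K) (n : ℕ) (x : Ω) :
    |birkhoffMax T f n x| ≤ (n + 1) * K := by
  have hK0 : 0 ≤ K := (abs_nonneg _).trans (hK x)
  induction n generalizing x with
  | zero => simpa [birkhoffMax] using hK x
  | succ n ih =>
    have h1 := abs_le.1 (hK x)
    have h2 := abs_le.1 (ih (T x))
    have h3 : (0 : ℝ) ≤ (n + 1) * K := by positivity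
    simp only [birkhoffMax]
    push_cast
    rw [abs_le]
    constructor
    · nlinarith [le_max_left 0 (birkhoffMax T f n (T x))]
    · nlinarith [max_le h3 h2.2]

variable [MeasurableSpace Ω] {μ : Measure Ω}

/-- If `∫ f < 0`, the Birkhoff sums of `f` are almost surely bounded above. -/
theorem Ergodic.ae_bddAbove_birkhoffMax [IsProbabilityMeasure μ] (hT : Ergodic T μ)
    {f : Ω → ℝ} (hf : Measurable f) {K : ℝ} (hK : ∀ x, |f x| ≤ K) (hneg : ∫ x, f x ∂μ < 0) :
    ∀ᵐ x ∂μ, BddAbove (range fun n => birkhoffMax T f n x) := by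
  have hTm := hT.measurable
  set A : Set Ω := {x | Tendsto (fun n => birkhoffMax T f n x) atTop atTop} with hA
  have hAm : MeasurableSet A := by
    have : A = ⋂ k : ℕ, ⋃ n : ℕ, {x | (k : ℝ) ≤ birkhoffMax T f n x} := by
      ext x
      simp only [hA, mem_ofPred_eq, mem_iInter, mem_iUnion]
      constructor
      · intro h k
        exact (h.eventually_ge_atTop (k : ℝ)).exists
      · intro h
        refine tendsto_atTop_atTop_of_monotone (birkhoffMax_mono f x) fun b => ?_
        obtain ⟨n, hn⟩ := h ⌈b⌉₊
        exact ⟨n, (Nat.le_ceil b).trans hn⟩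
    rw [this]
    exact MeasurableSet.iInter fun k => MeasurableSet.iUnion fun n =>
      measurableSet_le measurable_const (measurable_birkhoffMax hTm hf n)
  have hinv : T ⁻¹' A = A := by
    ext x
    simp only [hA, mem_preimage, mem_ofPred_eq]
    -- After an index shift the recursion `F_{n+1}(x) = f(x) + max 0 (F_n(Tx))` compares divergence
    -- at `x` with divergence at `Tx`.
    rw [← tendsto_add_atTop_iff_nat (f := fun n => birkhoffMax T f n x) 1]
    simp only [birkhoffMax]
    constructor
    · intro h
      exact tendsto_atTop_add_const_left _ _ (tendsto_atTop_mono (fun n => le_max_right _ _) h)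
    · intro h
      have h2 : Tendsto (fun n => max 0 (birkhoffMax T f n (T x))) atTop atTop := by
        simpa using tendsto_atTop_add_const_left _ (-f x) h
      refine h2.congr' ?_
      filter_upwards [h2.eventually_gt_atTop 0] with n hn
      rcases max_cases 0 (birkhoffMax T f n (T x)) with ⟨h3, h4⟩ | ⟨h3, h4⟩ <;> simp_all
  rcases hT.ae_mem_or_ae_notMem hAm hinv with h | h
  · exfalso
    have hint : ∀ n, Integrable (birkhoffMax T f n) μ := fun n =>
      Integrable.of_bound (measurable_birkhoffMax hTm hf n).aestronglyMeasurable ((n + 1) * K)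
        (Eventually.of_forall fun x => abs_birkhoffMax_le hK n x)
    have hintT : ∀ n, Integrable (fun x => birkhoffMax T f n (T x)) μ := fun n =>
      (hT.toMeasurePreserving.integrable_comp (hint n).aestronglyMeasurable).2 (hint n)
    have hcomp : ∀ n, ∫ x, birkhoffMax T f n (T x) ∂μ = ∫ x, birkhoffMax T f n x ∂μ := fun n => by
      have h1 := integral_map (μ := μ) (f := birkhoffMax T f n) hTm.aemeasurable
        (by rw [hT.map_eq]; exact (hint n).aestronglyMeasurable)
      rw [hT.map_eq] at h1
      exact h1.symm
    -- The integrand is `f + max 0 (F_n ∘ T) - F_n ∘ T`, which equals `f` once `F_n(Tx) ≥ 0`. Its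
    -- integral is that of `F_{n+1} - F_n ≥ 0` by invariance of `μ`, which contradicts `∫ f < 0`.
    -- Domination by `2K` holds because `F_n ≥ F_0 = f ≥ -K`.
    have key : Tendsto (fun n => ∫ x, (birkhoffMax T f (n + 1) x - birkhoffMax T f n (T x)) ∂μ)
        atTop (𝓝 (∫ x, f x ∂μ)) := by
      refine tendsto_integral_of_dominated_convergence (fun _ => 2 * K)
        (fun n => ((hint _).sub (hintT n)).aestronglyMeasurable) (integrable_const _)
        (fun n => Eventually.of_forall fun x => ?_) ?_
      · have h1 := abs_le.1 (hK x)
        have h2 := abs_le.1 (hK (T x))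
        have h3 := birkhoffMax_mono (T := T) f (T x) (Nat.zero_le n)
        simp only [birkhoffMax] at h3 ⊢
        rw [Real.norm_eq_abs, abs_le]
        rcases max_cases 0 (birkhoffMax T f n (T x)) with ⟨h4, h5⟩ | ⟨h4, h5⟩ <;>
          rw [h4] <;> constructor <;> linarith
      · filter_upwards [h] with x hx
        have hx' : T x ∈ A := by rwa [← hinv] at hx
        refine tendsto_const_nhds.congr' ?_
        filter_upwards [hx'.eventually_ge_atTop 0] with n hn
        simp [birkhoffMax, max_eq_right hn]
    have : 0 ≤ ∫ x, f x ∂μ := by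
      refine ge_of_tendsto' key fun n => ?_
      rw [integral_sub (hint _) (hintT n), hcomp, sub_nonneg]
      exact integral_mono (hint _) (hint _) (birkhoffMax_le_succ f n)
    linarith
  · filter_upwards [h] with x hx
    rcases tendsto_atTop_of_monotone (birkhoffMax_mono (T := T) f x) with h1 | ⟨l, hl⟩
    · exact absurd h1 hx
    · exact hl.bddAbove_range

/-- The function `f - (∫ f + ε)` has negative mean, so its sums are almost surely bounded by some
`B`. The second `ε` absorbs `B` once `n ≥ B / ε`. -/
theorem Ergodic.ae_eventually_birkhoffSum_le [IsProbabilityMeasure μ] (hT : Ergodic T μ)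
    {f : Ω → ℝ} (hf : Measurable f) {K : ℝ} (hK : ∀ x, |f x| ≤ K) {ε : ℝ} (hε : 0 < ε) :
    ∀ᵐ x ∂μ, ∀ᶠ n : ℕ in atTop, birkhoffSum T f n x ≤ n * (∫ y, f y ∂μ + 2 * ε) := by
  set a := ∫ y, f y ∂μ with ha
  have hint : Integrable f μ := Integrable.of_bound hf.aestronglyMeasurable K
    (Eventually.of_forall hK)
  have hg : ∫ x, (f x - (a + ε)) ∂μ < 0 := by
    rw [integral_sub hint (integrable_const _)]
    simp [← ha, hε]
  have hb := Ergodic.ae_bddAbove_birkhoffMax hT (f := fun x => f x - (a + ε))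
    (hf.sub measurable_const) (K := K + |a + ε|)
    (fun x => (abs_sub _ _).trans (add_le_add (hK x) le_rfl)) hg
  filter_upwards [hb] with x ⟨B, hB⟩
  have hsum : ∀ n, birkhoffSum T (fun x => f x - (a + ε)) n x
      = birkhoffSum T f n x - n * (a + ε) := fun n => by
    simp [birkhoffSum, Finset.sum_sub_distrib, mul_add]
  have hlim : ∀ᶠ n : ℕ in atTop, B / ε ≤ n := tendsto_natCast_atTop_atTop.eventually_ge_atTop _
  filter_upwards [hlim, eventually_ge_atTop 1] with n hn hn1
  obtain ⟨k, rfl⟩ : ∃ k, n = k + 1 := ⟨n - 1, by omega⟩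
  have h1 := (birkhoffSum_le_birkhoffMax (T := T) (fun x => f x - (a + ε)) k x).trans (hB ⟨k, rfl⟩)
  rw [hsum] at h1
  rw [div_le_iff₀ hε] at hn
  linarith

/-- Birkhoff's pointwise ergodic theorem for bounded measurable functions. -/
theorem Ergodic.ae_tendsto_birkhoffSum_div [IsProbabilityMeasure μ] (hT : Ergodic T μ)
    {f : Ω → ℝ} (hf : Measurable f) {K : ℝ} (hK : ∀ x, |f x| ≤ K) :
    ∀ᵐ x ∂μ, Tendsto (fun n : ℕ => birkhoffSum T f n x / n) atTop (𝓝 (∫ y, f y ∂μ)) := by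
  set a := ∫ y, f y ∂μ with ha
  have h1 : ∀ k : ℕ, ∀ᵐ x ∂μ, ∀ᶠ n : ℕ in atTop,
      birkhoffSum T f n x ≤ n * (a + 2 * (1 / (k + 1 : ℝ))) := fun k =>
    Ergodic.ae_eventually_birkhoffSum_le hT hf hK (by positivity)
  have h2 : ∀ k : ℕ, ∀ᵐ x ∂μ, ∀ᶠ n : ℕ in atTop,
      birkhoffSum T (fun x => -f x) n x ≤ n * (-a + 2 * (1 / (k + 1 : ℝ))) := fun k => by
    have := Ergodic.ae_eventually_birkhoffSum_le hT hf.neg (K := K) (fun x => by simpa using hK x)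
      (ε := 1 / (k + 1 : ℝ)) (by positivity)
    rw [integral_neg'] at this
    exact this
  filter_upwards [ae_all_iff.2 h1, ae_all_iff.2 h2] with x hx1 hx2
  rw [Metric.tendsto_atTop']
  intro ε hε
  obtain ⟨k, hk⟩ := exists_nat_one_div_lt (half_pos hε)
  have := (((hx1 k).and (hx2 k)).and (eventually_gt_atTop 0))
  obtain ⟨N, hN⟩ := eventually_atTop.1 this
  refine ⟨N, fun n hn => ?_⟩
  obtain ⟨⟨h3, h4⟩, h5⟩ := hN n hn.le
  have hn0 : (0 : ℝ) < n := by exact_mod_cast h5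
  have h6 : birkhoffSum T (fun x => -f x) n x = -birkhoffSum T f n x := by
    simp [birkhoffSum]
  rw [h6] at h4
  rw [Real.dist_eq, abs_lt]
  have e : birkhoffSum T f n x / n * n = birkhoffSum T f n x := by field_simp
  constructor <;> nlinarith
end Birkhoff

/-! ### Circle-valued cocycles and the Schwartzman group -/

section Cocycle

variable {Θ : Type*} [TopologicalSpace Θ] (T : Θ ≃ₜ Θ)

/-- The map `[θ, s] ↦ φ(θ) + s c(θ)` on the suspension, where `φ ∘ T = φ + c`. -/
def suspensionMap (φ : C(Θ, UnitAddCircle)) (c : C(Θ, ℝ))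
    (h : ∀ θ, φ (T θ) = φ θ + (c θ : UnitAddCircle)) : C(Suspension T, UnitAddCircle) where
  toFun := Quot.lift (fun p => φ p.1 + ((p.2 * c p.1 : ℝ) : UnitAddCircle)) (by
    rintro ⟨θ, s⟩ ⟨η, r⟩ ⟨h1, h2⟩
    obtain ⟨rfl, rfl⟩ := Prod.ext_iff.1 h2
    simp only at h1
    subst h1
    simp [h])
  continuous_toFun := continuous_quot_lift _ (by
    refine (φ.continuous.comp continuous_fst).add ((AddCircle.continuous_mk' 1).comp ?_)
    fun_prop)

/-- The function `[θ, s] ↦ ∑_{k < n} c(T^k θ) + s (c(T^n θ) - c(θ))` on the suspension. -/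
def suspensionSum (c : C(Θ, ℝ)) (n : ℕ) : C(Suspension T, ℝ) where
  toFun := Quot.lift (fun p => birkhoffSum T c n p.1 + p.2 * (c (T^[n] p.1) - c p.1)) (by
    rintro ⟨θ, s⟩ ⟨η, r⟩ ⟨h1, h2⟩
    obtain ⟨rfl, rfl⟩ := Prod.ext_iff.1 h2
    simp only at h1
    subst h1
    -- Gluing: the Birkhoff sum at `Tθ` is the one at `θ` plus `c(T^n θ) - c(θ)`, the value of the
    -- correction at `s = 1`.
    have h3 := birkhoffSum_succ T c n θ
    rw [birkhoffSum_succ'] at h3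
    simp only [Set.Icc.coe_one, Set.Icc.coe_zero]
    linarith)
  continuous_toFun := continuous_quot_lift _ (by
    have h1 : ∀ k : ℕ, Continuous fun p : Θ × unitInterval => c (T^[k] p.1) := fun k =>
      c.continuous.comp ((T.continuous.iterate k).comp continuous_fst)
    have h2 : Continuous fun p : Θ × unitInterval => birkhoffSum T c n p.1 := by
      simp only [birkhoffSum]
      exact continuous_finsetSum _ fun k _ => h1 k
    exact h2.add ((continuous_subtype_val.comp continuous_snd).mul ((h1 n).sub (h1 0))))

variable {T}

/-- The function `r ↦ ∫₀^r c(T^⌊x⌋ θ) dx`. -/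
def orbitIntegral (T : Θ ≃ₜ Θ) (c : C(Θ, ℝ)) (θ : Θ) (r : ℝ) : ℝ :=
  ∫ x in (0 : ℝ)..r, c ((T ^ ⌊x⌋) θ)

variable {c : C(Θ, ℝ)} {K : ℝ}

theorem intervalIntegrable_orbit (hK : ∀ θ, ‖c θ‖ ≤ K) (θ : Θ) (a b : ℝ) :
    IntervalIntegrable (fun x : ℝ => c ((T ^ ⌊x⌋) θ)) volume a b := by
  have hm : Measurable fun x : ℝ => c ((T ^ ⌊x⌋) θ) :=
    (measurable_from_top (f := fun n : ℤ => c ((T ^ n) θ))).comp Int.measurable_floor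
  refine (intervalIntegrable_const (c := K)).mono_fun hm.aestronglyMeasurable ?_
  exact Eventually.of_forall fun x => (hK _).trans (le_abs_self K)

theorem orbitIntegral_sub (hK : ∀ θ, ‖c θ‖ ≤ K) (θ : Θ) (a b : ℝ) :
    orbitIntegral T c θ b - orbitIntegral T c θ a = ∫ x in a..b, c ((T ^ ⌊x⌋) θ) :=
  intervalIntegral.integral_interval_sub_left (intervalIntegrable_orbit hK θ _ _)
    (intervalIntegrable_orbit hK θ _ _)

theorem orbitIntegral_add (hK : ∀ θ, ‖c θ‖ ≤ K) (θ : Θ) (n : ℤ) {s : ℝ} (h0 : 0 ≤ s)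
    (h1 : s ≤ 1) :
    orbitIntegral T c θ (n + s) = orbitIntegral T c θ n + s * c ((T ^ n) θ) := by
  rw [← sub_eq_iff_eq_add', orbitIntegral_sub hK]
  have h : ∫ x in (n : ℝ)..(n + s), c ((T ^ ⌊x⌋) θ) = ∫ x in (n : ℝ)..(n + s), c ((T ^ n) θ) := by
    refine intervalIntegral.integral_congr_ae ?_
    -- For `s = 1` the floor jumps at the right endpoint, which is a null set.
    have hne : ∀ᵐ x : ℝ, x ≠ n + 1 := by
      simp [ae_iff]
    filter_upwards [hne] with x hx hmem
    rw [uIoc_of_le (by linarith)] at hmem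
    have : ⌊x⌋ = n := Int.floor_eq_iff.2 ⟨hmem.1.le, lt_of_le_of_ne (by linarith [hmem.2]) hx⟩
    rw [this]
  rw [h]
  simp

theorem orbitIntegral_natCast (hK : ∀ θ, ‖c θ‖ ≤ K) (θ : Θ) (n : ℕ) :
    orbitIntegral T c θ n = birkhoffSum T c n θ := by
  induction n with
  | zero => simp [orbitIntegral]
  | succ n ih =>
    have h := orbitIntegral_add hK θ (n : ℤ) zero_le_one le_rfl (T := T)
    rw [birkhoffSum_succ, ← ih]
    push_cast at h ⊢
    rw [h, one_mul, zpow_natCast]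
    congr 2
    clear h ih
    induction n with
    | zero => rfl
    | succ n ih => rw [pow_succ', Homeomorph.mul_apply, ih, Function.iterate_succ_apply']

/-- The relation `φ ∘ T = φ + c` is iterated forwards and backwards; both sides have the same
increments in `n`. -/
theorem orbitIntegral_intCast (hK : ∀ θ, ‖c θ‖ ≤ K) {φ : C(Θ, UnitAddCircle)}
    (h : ∀ θ, φ (T θ) = φ θ + (c θ : UnitAddCircle)) (θ : Θ) (n : ℤ) :
    φ ((T ^ n) θ) = φ θ + (orbitIntegral T c θ n : UnitAddCircle) := by
  have step : ∀ n : ℤ, φ ((T ^ (n + 1)) θ) - φ ((T ^ n) θ)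
      = (orbitIntegral T c θ (n + 1 : ℤ) : UnitAddCircle) - (orbitIntegral T c θ n) := fun n => by
    have h1 := orbitIntegral_add hK θ n zero_le_one le_rfl (T := T)
    rw [Int.cast_add, Int.cast_one, h1, add_comm n 1, zpow_add, zpow_one, Homeomorph.mul_apply, h]
    simp
  induction n using Int.induction_on with
  | zero => simp [orbitIntegral]
  | succ n ih =>
    have := step n
    rw [ih, sub_eq_iff_eq_add] at this
    rw [this]
    abel
  | pred n ih =>
    have := step (-n - 1)
    rw [sub_add_cancel, ih] at this
    rw [← sub_eq_zero] at this ⊢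
    rw [← neg_eq_zero, ← this]
    abel

theorem continuous_orbitIntegral (hK : ∀ θ, ‖c θ‖ ≤ K) (θ : Θ) :
    Continuous (orbitIntegral T c θ) :=
  intervalIntegral.continuous_primitive (fun a b => intervalIntegrable_orbit hK θ a b) 0

theorem abs_orbitIntegral_sub_le (hK : ∀ θ, ‖c θ‖ ≤ K) (θ : Θ) (a b : ℝ) :
    |orbitIntegral T c θ b - orbitIntegral T c θ a| ≤ K * |b - a| := by
  rw [orbitIntegral_sub hK]
  exact intervalIntegral.norm_integral_le_of_norm_le_const fun x _ => hK _

/-- This provides an explicit real lift along each orbit, to which the definition of mean winding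
can be applied. -/
theorem suspensionMap_mkReal (hK : ∀ θ, ‖c θ‖ ≤ K) {φ : C(Θ, UnitAddCircle)}
    (h : ∀ θ, φ (T θ) = φ θ + (c θ : UnitAddCircle)) (θ : Θ) (r : ℝ) :
    suspensionMap T φ c h (Suspension.mkReal T θ r)
      = φ θ + (orbitIntegral T c θ r : UnitAddCircle) := by
  have h1 := orbitIntegral_add hK θ ⌊r⌋ (Int.fract_nonneg r) (Int.fract_lt_one r).le (T := T)
  rw [Int.floor_add_fract] at h1
  rw [h1]
  change φ ((T ^ ⌊r⌋) θ) + ((Int.fract r * c ((T ^ ⌊r⌋) θ) : ℝ) : UnitAddCircle) = _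
  rw [orbitIntegral_intCast hK h, AddCircle.coe_add]
  abel

/-- The integral up to `s + t` differs from the Birkhoff sum of length `⌊t⌋₊` by at most `2K`,
because `s + t` is within `2` of `⌊t⌋₊`. -/
theorem tendsto_orbitIntegral_div (hK : ∀ θ, ‖c θ‖ ≤ K) (θ : Θ) {s a : ℝ} (hs : s ∈ Icc (0 : ℝ) 1)
    (h : Tendsto (fun n : ℕ => birkhoffSum T c n θ / n) atTop (𝓝 a)) (b : ℝ) :
    Tendsto (fun t : ℝ => (b + orbitIntegral T c θ (s + t)) / t) atTop (𝓝 a) := by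
  have h1 : Tendsto (fun t : ℝ => birkhoffSum T c ⌊t⌋₊ θ / ⌊t⌋₊ * (⌊t⌋₊ / t)) atTop (𝓝 (a * 1)) :=
    (h.comp tendsto_nat_floor_atTop).mul (tendsto_nat_floor_div_atTop (R := ℝ))
  have h2 : Tendsto (fun t : ℝ => (b + orbitIntegral T c θ (s + t)
      - birkhoffSum T c ⌊t⌋₊ θ) / t) atTop (𝓝 0) := by
    refine squeeze_zero_norm' ?_ (tendsto_id.const_div_atTop (|b| + K * 2))
    filter_upwards [eventually_gt_atTop 0] with t ht
    rw [norm_div, Real.norm_of_nonneg ht.le]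
    refine div_le_div_of_nonneg_right ?_ ht.le
    rw [← orbitIntegral_natCast hK, add_sub_assoc]
    refine (norm_add_le _ _).trans (add_le_add le_rfl ?_)
    refine (abs_orbitIntegral_sub_le hK θ _ _).trans ?_
    refine mul_le_mul_of_nonneg_left ?_ ((norm_nonneg _).trans (hK θ))
    rw [abs_le]
    have := Nat.floor_le ht.le
    have := Nat.lt_floor_add_one t
    constructor <;> linarith [hs.1, hs.2]
  have h3 := h2.add h1
  rw [zero_add, mul_one] at h3
  refine h3.congr' ?_
  filter_upwards [eventually_ge_atTop 1] with t ht
  have ht0 : t ≠ 0 := by positivity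
  have hf : (⌊t⌋₊ : ℝ) ≠ 0 := by
    have := Nat.floor_pos.2 ht
    positivity
  field_simp
  ring

/-- If `φ ∘ T = φ + c` modulo `1` then `∫ c dμ` belongs to the Schwartzman group. -/
theorem integral_mem_schwartzmanGroup {Θ : Type*} [MetricSpace Θ] [CompactSpace Θ]
    [MeasurableSpace Θ] [BorelSpace Θ] {μ : Measure Θ} [IsProbabilityMeasure μ] {T : Θ ≃ₜ Θ}
    (hT : Ergodic T μ) (φ : C(Θ, UnitAddCircle)) (c : C(Θ, ℝ))
    (h : ∀ θ, φ (T θ) = φ θ + (c θ : UnitAddCircle)) :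
    ∫ θ, c θ ∂μ ∈ schwartzmanGroup T μ := by
  obtain ⟨K, hK'⟩ := (isCompact_range c.continuous.norm).bddAbove
  have hK : ∀ θ, ‖c θ‖ ≤ K := fun θ => hK' ⟨θ, rfl⟩
  set a := ∫ θ, c θ ∂μ
  refine ⟨Quotient.mk (homotopySetoid T) (suspensionMap T φ c h), ?_⟩
  change HasMeanWinding T μ (suspensionMap T φ c h) a
  -- An almost sure statement about the pushforward measure is pulled back to the product through a
  -- measurable set. Continuous functions on the suspension define one, and the correction in
  -- `suspensionSum` is bounded, so it does not affect the limit.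
  set G : Set (Suspension T) := {x | Tendsto (fun n : ℕ => suspensionSum T c n x / n) atTop (𝓝 a)}
  have hG : MeasurableSet G := measurableSet_tendsto (𝓝 a) fun n =>
    (suspensionSum T c n).continuous.measurable.div_const _
  have herr : ∀ (θ : Θ) (s : unitInterval), Tendsto (fun n : ℕ =>
      (s * (c (T^[n] θ) - c θ) : ℝ) / n) atTop (𝓝 0) := fun θ s => by
    refine squeeze_zero_norm (fun n => ?_)
      (tendsto_natCast_atTop_atTop.const_div_atTop (K + K) (l := atTop) (g := fun n : ℕ => (n : ℝ)))
    rw [norm_div, Real.norm_natCast]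
    refine div_le_div_of_nonneg_right ?_ n.cast_nonneg
    rw [norm_mul, Real.norm_of_nonneg s.2.1]
    refine (mul_le_of_le_one_left (norm_nonneg _) s.2.2).trans ?_
    exact (norm_sub_le _ _).trans (add_le_add (hK _) (hK _))
  have hmem : ∀ (θ : Θ) (s : unitInterval), Suspension.mk T (θ, s) ∈ G ↔
      Tendsto (fun n : ℕ => birkhoffSum T c n θ / n) atTop (𝓝 a) := fun θ s => by
    change Tendsto (fun n : ℕ => (birkhoffSum T c n θ + s * (c (T^[n] θ) - c θ)) / n) atTop (𝓝 a) ↔ _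
    constructor
    · intro hx
      have := hx.sub (herr θ s)
      simpa [add_div] using this
    · intro hx
      have := hx.add (herr θ s)
      simpa [add_div] using this
  have hae : ∀ᵐ x ∂(Suspension.measure T μ), x ∈ G := by
    refine (ae_map_iff (p := fun x => x ∈ G)
      (Suspension.continuous_mk T).measurable.aemeasurable hG).2 ?_
    have hb := Ergodic.ae_tendsto_birkhoffSum_div hT c.continuous.measurable hK
    have hq : Measure.QuasiMeasurePreserving Prod.fst (μ.prod (volume : Measure unitInterval)) μ :=
      Measure.quasiMeasurePreserving_fst
    filter_upwards [hq.ae hb] with p hp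
    exact (hmem p.1 p.2).2 hp
  filter_upwards [hae] with x hx
  induction x using Quot.ind with
  | mk p =>
  obtain ⟨θ, s⟩ := p
  obtain ⟨b, hb⟩ := QuotientAddGroup.mk_surjective (φ θ)
  refine ⟨⟨fun t => b + orbitIntegral T c θ (s + t), ?_⟩, fun t => ?_, ?_⟩
  · exact continuous_const.add ((continuous_orbitIntegral hK θ).comp (continuous_const.add continuous_id))
  · change ((b + orbitIntegral T c θ (s + t) : ℝ) : UnitAddCircle)
      = suspensionMap T φ c h (Suspension.mkReal T θ (s + t))
    rw [suspensionMap_mkReal hK, AddCircle.coe_add, ← hb]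
  · exact tendsto_orbitIntegral_div hK θ s.2 ((hmem θ s).1 hx) b

end Cocycle

/-! ### Logarithmic derivative of determinants -/

/-- Jacobi's formula for the derivative of the determinant at an invertible matrix. -/
theorem hasDerivAt_det {ι : Type*} [Fintype ι] [DecidableEq ι] {Y : ℝ → Matrix ι ι ℂ}
    {Y' : Matrix ι ι ℂ} {s : ℝ} (hY : ∀ i j, HasDerivAt (fun t => Y t i j) (Y' i j) s)
    (h : (Y s).det ≠ 0) :
    HasDerivAt (fun t => (Y t).det) ((Y s).det * ∑ i, (Y' * (Y s)⁻¹) i i) s := by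
  let D : ContinuousMultilinearMap ℂ (fun _ : ι => ι → ℂ) ℂ :=
    ⟨(Matrix.detRowAlternating (n := ι) (R := ℂ)).toMultilinearMap, by
      change Continuous fun A : Matrix ι ι ℂ => A.det
      exact continuous_id.matrix_det⟩
  have hY1 : HasDerivAt (fun t => (fun i j => Y t i j : ι → ι → ℂ)) (fun i j => Y' i j) s :=
    hasDerivAt_pi.2 fun i => hasDerivAt_pi.2 fun j => hY i j
  have hD := ((D.hasFDerivAt (fun i j => Y s i j)).restrictScalars ℝ).comp_hasDerivAt s hY1
  have e : (D.linearDeriv (fun i j => Y s i j)) (fun i j => Y' i j)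
      = (Y s).det * ∑ i, (Y' * (Y s)⁻¹) i i := by
    rw [ContinuousMultilinearMap.linearDeriv_apply, Finset.mul_sum]
    refine Finset.sum_congr rfl fun i _ => ?_
    -- Expanding the new row in the rows of `Y`, only the coefficient of row `i` survives in the
    -- determinant with row `i` replaced.
    have h1 : Y' i = ∑ k, (Y' * (Y s)⁻¹) i k • (Y s) k := by
      have h2 : Y' * (Y s)⁻¹ * Y s = Y' := by
        rw [Matrix.mul_assoc, Matrix.nonsing_inv_mul _ (isUnit_iff_ne_zero.2 h), Matrix.mul_one]
      funext j
      conv_lhs => rw [← h2]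
      simp [Matrix.mul_apply (N := Y s)]
    have h3 := Matrix.det_updateRow_sum (Y s) i fun k => (Y' * (Y s)⁻¹) i k
    rw [← h1, smul_eq_mul, mul_comm] at h3
    exact h3
  have := hD
  rw [← e]
  exact this

/-! ### Determinants twisting a projection by almost commuting phases -/

section Determinant

variable {𝓗 : Type*} [NormedAddCommGroup 𝓗] [InnerProductSpace ℂ 𝓗] {κ : Type*}

/-- The matrix entries of an operator. -/
def entry (e : κ → 𝓗) (P : 𝓗 →L[ℂ] 𝓗) (i j : κ) : ℂ := inner ℂ (e i) (P (e j))

/-- The diagonal unitary with entries `z`, which are `1` off the finite set `F`, commutes with `P`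
on the range of `P` up to an error of norm `ε`. -/
def AlmostCommutes (e : κ → 𝓗) (P : 𝓗 →L[ℂ] 𝓗) (F : Finset κ) (z : κ → ℂ) (ε : ℝ) : Prop :=
  ∃ M : 𝓗 →L[ℂ] 𝓗, (∀ x, ‖M x‖ = ‖x‖) ∧
    (∀ x, M x = x + ∑ i ∈ F, ((z i - 1) * inner ℂ (e i) x) • e i) ∧
    ∀ x, ‖M (P x) - P (M (P x))‖ ≤ ε * ‖x‖

/-- `P` is an idempotent such that `P` and `1 - P` are contractions. -/
structure IsProj (P : 𝓗 →L[ℂ] 𝓗) : Prop where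
  idem : ∀ x, P (P x) = P x
  norm_le : ∀ x, ‖P x‖ ≤ ‖x‖
  norm_compl_le : ∀ x, ‖x - P x‖ ≤ ‖x‖

/-- Let `y = x + (M - 1) P x`. Then `P y = P M P x` has nearly the norm of `P x`, and `x - P x` is
`y - P y` up to `ε ‖P x‖`. With `ε ≤ 1/4` both parts of `x` are at most `(4/3) ‖y‖`, and `8/3 ≤ 3`.
-/
theorem IsProj.norm_le_three {P M : 𝓗 →L[ℂ] 𝓗} (hP : IsProj P) (hM : ∀ x, ‖M x‖ = ‖x‖) {ε : ℝ}
    (hε : ε ≤ 1 / 4) (h : ∀ x, ‖M (P x) - P (M (P x))‖ ≤ ε * ‖x‖) (x : 𝓗) :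
    ‖x‖ ≤ 3 * ‖x + (M (P x) - P x)‖ := by
  set y := x + (M (P x) - P x) with hy
  have hx' := h (P x)
  rw [hP.idem] at hx'
  have h1 : P y = P (M (P x)) := by simp [hy, hP.idem]
  have h2 : ‖P x‖ ≤ ‖P y‖ + ε * ‖P x‖ := by
    rw [← hM (P x), h1]
    calc ‖M (P x)‖ = ‖P (M (P x)) + (M (P x) - P (M (P x)))‖ := by congr 1; abel
      _ ≤ ‖P (M (P x))‖ + ‖M (P x) - P (M (P x))‖ := norm_add_le _ _
      _ ≤ _ := by rw [hM]; linarith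
  have h3 : x - P x = (y - P y) - (M (P x) - P (M (P x))) := by rw [h1, hy]; abel
  have h4 : ‖x - P x‖ ≤ ‖y‖ + ε * ‖P x‖ := by
    rw [h3]
    exact (norm_sub_le _ _).trans (add_le_add (hP.norm_compl_le y) hx')
  have h5 : ‖x‖ ≤ ‖P x‖ + ‖x - P x‖ := by
    calc ‖x‖ = ‖P x + (x - P x)‖ := by congr 1; abel
      _ ≤ _ := norm_add_le _ _
  have h6 := hP.norm_le y
  nlinarith [norm_nonneg (P x), norm_nonneg y]

variable {e : κ → 𝓗} {P : 𝓗 →L[ℂ] 𝓗} {F : Finset κ} {z : κ → ℂ} {ε : ℝ}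

/-- The vector with the coordinates `x` in the basis `e`. -/
def synth (e : κ → 𝓗) (F : Finset κ) (x : F → ℂ) : 𝓗 := ∑ j : F, x j • e j

theorem inner_synth (he : Orthonormal ℂ e) (x : F → ℂ) (i : F) :
    inner ℂ (e i) (synth e F x) = x i := by
  have := (he.comp (fun i : F => (i : κ)) Subtype.val_injective).inner_right_fintype x i
  rw [synth]
  exact this

theorem inner_apply_synth (x : F → ℂ) (i : κ) :
    inner ℂ (e i) (P (synth e F x)) = ∑ j : F, entry e P i j * x j := by
  simp only [synth, entry, map_sum, inner_sum, map_smul, inner_smul_right, mul_comm]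

theorem synth_injective (he : Orthonormal ℂ e) : Function.Injective (synth e F) := fun x y h => by
  funext i
  rw [← inner_synth he x i, h, inner_synth he]

variable [DecidableEq κ]

/-- The matrix of `1 + (M - 1) P` on a finite set of basis vectors, where `M` is diagonal with
entries `z` and `P` has the entries `p`. -/
def twistMatrix (F : Finset κ) (p : κ → κ → ℂ) (z : κ → ℂ) : Matrix F F ℂ :=
  1 + Matrix.of fun i j : F => (z i - 1) * p i j

/-- The determinant of `1 + (M - 1) P`. -/
def twistDet (F : Finset κ) (p : κ → κ → ℂ) (z : κ → ℂ) : ℂ := (twistMatrix F p z).det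

/-- The range of `M - 1` lies in the span of the `e i` with `i ∈ F`, so `1 + (M - 1) P` preserves
this span. Operator bounds thereby become bounds for a finite matrix. -/
theorem add_apply_synth {M : 𝓗 →L[ℂ] 𝓗}
    (hM : ∀ x, M x = x + ∑ i ∈ F, ((z i - 1) * inner ℂ (e i) x) • e i) (x : F → ℂ) :
    synth e F x + (M (P (synth e F x)) - P (synth e F x))
      = synth e F ((twistMatrix F (entry e P) z).mulVec x) := by
  rw [hM, add_sub_cancel_left, ← Finset.sum_coe_sort F]
  simp only [inner_apply_synth]
  rw [twistMatrix, Matrix.add_mulVec, Matrix.one_mulVec]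
  simp only [synth, Pi.add_apply, add_smul, Finset.sum_add_distrib]
  congr 1
  refine Finset.sum_congr rfl fun i _ => ?_
  congr 1
  rw [Matrix.mulVec, dotProduct, Finset.mul_sum]
  exact Finset.sum_congr rfl fun j _ => by simp [mul_assoc]

theorem twistDet_ne_zero (he : Orthonormal ℂ e) (hP : IsProj P) (hε : ε ≤ 1 / 4)
    (h : AlmostCommutes e P F z ε) : twistDet F (entry e P) z ≠ 0 := by
  obtain ⟨M, hM1, hM2, hM3⟩ := h
  intro h0
  obtain ⟨x, hx, hx0⟩ := Matrix.exists_mulVec_eq_zero_iff.2 h0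
  apply hx
  have h1 := hP.norm_le_three hM1 hε hM3 (synth e F x)
  rw [add_apply_synth hM2, hx0] at h1
  have h2 : synth e F (0 : F → ℂ) = 0 := by simp [synth]
  rw [h2, norm_zero, mul_zero] at h1
  exact synth_injective he (by rw [h2]; exact norm_le_zero_iff.1 h1)

/-- Let `v` solve `v + (M - 1) P v = e i`, so that `‖v‖ ≤ 3`. Applying `P` gives `P M P v = P (e
i)`, and the matrix entry is `⟨e i, M P v⟩`. The difference is thus controlled by `(M P - P M P) v`,
of norm at most `ε ‖v‖`. -/
theorem norm_mul_inv_sub_le (he : Orthonormal ℂ e) (hP : IsProj P) (hε0 : 0 ≤ ε) (hε : ε ≤ 1 / 4)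
    (h : AlmostCommutes e P F z ε) (i : F) :
    ‖(Matrix.of (fun i j : F => z i * entry e P i j) * (twistMatrix F (entry e P) z)⁻¹) i i
      - entry e P i i‖ ≤ 3 * ε := by
  have hdet := twistDet_ne_zero he hP hε h
  obtain ⟨M, hM1, hM2, hM3⟩ := h
  set Y := twistMatrix F (entry e P) z
  set x : F → ℂ := fun j => Y⁻¹ j i with hx
  have hYx : Y.mulVec x = Pi.single i 1 := by
    have h1 : Y * Y⁻¹ = 1 := Matrix.mul_nonsing_inv _ (isUnit_iff_ne_zero.2 hdet)
    funext j
    have h2 := congrFun (congrFun h1 j) i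
    rw [Matrix.mul_apply] at h2
    simp only [Matrix.mulVec, dotProduct, hx, h2, Matrix.one_apply, Pi.single_apply]
  have hsingle : synth e F (Pi.single i 1) = e i := by
    simp [synth, Pi.single_apply]
  have hadd := add_apply_synth (P := P) hM2 x
  rw [hYx, hsingle] at hadd
  have hnorm := hP.norm_le_three hM1 hε hM3 (synth e F x)
  rw [hadd, he.1, mul_one] at hnorm
  set v := synth e F x
  have hPe : P (M (P v)) = P (e i) := by
    rw [← hadd]
    simp [hP.idem]
  have h3 : inner ℂ (e i) (M (P v)) = z i * inner ℂ (e i) (P v) := by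
    rw [hM2, inner_add_right, inner_sum]
    simp only [inner_smul_right]
    rw [Finset.sum_eq_single (i : κ)]
    · rw [inner_self_eq_norm_sq_to_K, he.1]
      push_cast
      ring
    · intro b _ hb
      rw [he.2 hb.symm, mul_zero]
    · intro hb
      exact absurd i.2 hb
  have h4 : (Matrix.of (fun i j : F => z i * entry e P i j) * Y⁻¹) i i
      = inner ℂ (e i) (M (P v)) := by
    rw [h3, inner_apply_synth, Matrix.mul_apply, Finset.mul_sum]
    exact Finset.sum_congr rfl fun j _ => by simp [hx, mul_assoc]
  rw [h4, entry, ← hPe, ← inner_sub_right]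
  refine (norm_inner_le_norm _ _).trans ?_
  rw [he.1, one_mul]
  refine (hM3 v).trans ?_
  nlinarith

/-- Along the phases `q + s d` the logarithmic derivative is `2πi ∑ d_i (M P Y⁻¹)_{ii}`, with `Y = 1
+ (M - 1) P`. Replacing each diagonal entry by that of `P` costs `3ε`, so the total error is at most
`2π · 3ε · D`. -/
theorem twistDet_ratio (he : Orthonormal ℂ e) (hP : IsProj P) (hε0 : 0 ≤ ε) (hε : ε ≤ 1 / 4)
    {q d : κ → ℝ} (h : ∀ s ∈ Icc (0 : ℝ) 1,
      AlmostCommutes e P F (fun i => Complex.exp (2 * Real.pi * Complex.I * (q i + s * d i))) ε)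
    {D : ℝ} (hD : ∑ i ∈ F, |d i| ≤ D) :
    ‖twistDet F (entry e P) (fun i => Complex.exp (2 * Real.pi * Complex.I * (q i + d i)))
      / twistDet F (entry e P) (fun i => Complex.exp (2 * Real.pi * Complex.I * q i))
      * Complex.exp (-(2 * Real.pi * Complex.I * ∑ i ∈ F, d i * entry e P i i)) - 1‖
      ≤ Real.exp (6 * Real.pi * ε * D) - 1 := by
  set z : ℝ → κ → ℂ := fun s i => Complex.exp (2 * Real.pi * Complex.I * (q i + s * d i)) with hz
  set p := entry e P
  set A := ∑ i ∈ F, (d i : ℂ) * p i i with hA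
  set K := 6 * Real.pi * ε * D with hK
  have hD0 : 0 ≤ D := (Finset.sum_nonneg fun i _ => abs_nonneg _).trans hD
  have hK0 : 0 ≤ K := by positivity
  have hne : ∀ s ∈ Icc (0 : ℝ) 1, twistDet F p (z s) ≠ 0 := fun s hs =>
    twistDet_ne_zero he hP hε (h s hs)
  set R : ℝ → ℂ := fun s => ∑ i : F, 2 * Real.pi * Complex.I * d i *
    (Matrix.of (fun i j : F => z s i * p i j) * (twistMatrix F p (z s))⁻¹) i i with hR
  have hderiv : ∀ s ∈ Icc (0 : ℝ) 1,
      HasDerivAt (fun s => twistDet F p (z s)) (twistDet F p (z s) * R s) s := fun s hs => by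
    have hz' : ∀ i, HasDerivAt (fun s => z s i) (2 * Real.pi * Complex.I * d i * z s i) s := fun i => by
      have h1 : HasDerivAt (fun s : ℝ => (2 * Real.pi * Complex.I * (q i + s * d i) : ℂ))
          (2 * Real.pi * Complex.I * d i) s := by
        have h2 := (((hasDerivAt_id s).ofReal_comp.mul_const (d i : ℂ)).const_add (q i : ℂ)).const_mul
          (2 * Real.pi * Complex.I : ℂ)
        simpa using h2
      have := h1.cexp
      rw [mul_comm]
      exact this
    have hY : ∀ i j : F, HasDerivAt (fun t => twistMatrix F p (z t) i j)
        ((Matrix.of fun i j : F => 2 * Real.pi * Complex.I * d i * (z s i * p i j)) i j) s :=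
      fun i j => by
        have h1 := (((hz' i).sub_const 1).mul_const (p i j)).const_add ((1 : Matrix F F ℂ) i j)
        simp only [twistMatrix, Matrix.add_apply, Matrix.of_apply, ← mul_assoc] at h1 ⊢
        exact h1
    have h2 := hasDerivAt_det hY (hne s hs)
    have h3 : R s = ∑ i, ((Matrix.of fun i j : F => 2 * Real.pi * Complex.I * d i * (z s i * p i j))
        * (twistMatrix F p (z s))⁻¹) i i := by
      refine Finset.sum_congr rfl fun i _ => ?_
      rw [Matrix.mul_apply, Matrix.mul_apply, Finset.mul_sum]
      exact Finset.sum_congr rfl fun j _ => by simp only [Matrix.of_apply]; ring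
    rw [h3]
    exact h2
  have hRA : ∀ s ∈ Icc (0 : ℝ) 1, ‖R s - 2 * Real.pi * Complex.I * A‖ ≤ K := fun s hs => by
    have h1 : R s - 2 * Real.pi * Complex.I * A = ∑ i : F, 2 * Real.pi * Complex.I * d i *
        ((Matrix.of (fun i j : F => z s i * p i j) * (twistMatrix F p (z s))⁻¹) i i - p i i) := by
      rw [hA, ← Finset.sum_coe_sort F, Finset.mul_sum, ← Finset.sum_sub_distrib]
      exact Finset.sum_congr rfl fun i _ => by ring
    rw [h1]
    refine (norm_sum_le _ _).trans ?_
    have h2 : ∀ i : F, ‖2 * Real.pi * Complex.I * d i *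
        ((Matrix.of (fun i j : F => z s i * p i j) * (twistMatrix F p (z s))⁻¹) i i - p i i)‖
        ≤ |d i| * (6 * Real.pi * ε) := fun i => by
      rw [norm_mul, norm_mul, norm_mul, norm_mul, Complex.norm_I, Complex.norm_real,
        Complex.norm_real, Real.norm_eq_abs, Real.norm_eq_abs, abs_of_pos Real.pi_pos]
      have h3 := norm_mul_inv_sub_le he hP hε0 hε (h s hs) i
      have h4 : (0 : ℝ) ≤ 2 * Real.pi * |d i| := by positivity
      simp only [Complex.norm_ofNat, mul_one]
      calc _ ≤ 2 * Real.pi * |d i| * (3 * ε) := mul_le_mul_of_nonneg_left h3 h4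
        _ = _ := by ring
    refine (Finset.sum_le_sum fun i _ => h2 i).trans ?_
    rw [← Finset.sum_mul, Finset.sum_coe_sort F fun i => |d i|, hK, mul_comm _ D]
    exact mul_le_mul_of_nonneg_right hD (by positivity)
  set g : ℝ → ℂ := fun s => twistDet F p (z s) / twistDet F p (z 0)
    * Complex.exp (-(2 * Real.pi * Complex.I * (s * A))) - 1 with hg
  have hgd : ∀ s ∈ Icc (0 : ℝ) 1,
      HasDerivAt g ((g s + 1) * (R s - 2 * Real.pi * Complex.I * A)) s := fun s hs => by
    have h1 : HasDerivAt (fun s : ℝ => (-(2 * Real.pi * Complex.I * (s * A)) : ℂ))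
        (-(2 * Real.pi * Complex.I * A)) s := by
      have h2 := (((hasDerivAt_id s).ofReal_comp.mul_const A).const_mul
        (2 * Real.pi * Complex.I : ℂ)).neg
      simp only [id_eq, Complex.ofReal_one, one_mul] at h2
      exact h2
    have h2 := ((((hderiv s hs).div_const (twistDet F p (z 0))).mul h1.cexp)).sub_const 1
    convert! h2 using 1
    simp only [hg]
    ring
  -- Since `g' = (g + 1)(R - 2πiA)`, one has `‖g'‖ ≤ K ‖g‖ + K` and `g 0 = 0`; Grönwall gives `e^K -
  -- 1` at time `1`.
  have hbound := norm_le_gronwallBound_of_norm_deriv_right_le (f := g)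
    (f' := fun s => (g s + 1) * (R s - 2 * Real.pi * Complex.I * A)) (δ := 0) (K := K) (ε := K)
    (a := 0) (b := 1) (fun s hs => (hgd s hs).continuousAt.continuousWithinAt)
    (fun s hs => (hgd s (Ico_subset_Icc_self hs)).hasDerivWithinAt)
    (by
      have := hne 0 ⟨le_rfl, zero_le_one⟩
      simp [hg, this])
    (fun s hs => by
      rw [norm_mul]
      have h1 := hRA s (Ico_subset_Icc_self hs)
      have h2 : ‖g s + 1‖ ≤ ‖g s‖ + 1 := by simpa using norm_add_le (g s) 1
      calc _ ≤ (‖g s‖ + 1) * K := mul_le_mul h2 h1 (norm_nonneg _) (by positivity)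
        _ = _ := by ring) 1 ⟨zero_le_one, le_rfl⟩
  have hz1 : z 1 = fun i => Complex.exp (2 * Real.pi * Complex.I * (q i + d i)) := by
    funext i; simp [hz]
  have hz0 : z 0 = fun i => Complex.exp (2 * Real.pi * Complex.I * q i) := by
    funext i; simp [hz]
  have hg1 : g 1 = twistDet F p (z 1) / twistDet F p (z 0)
      * Complex.exp (-(2 * Real.pi * Complex.I * A)) - 1 := by simp [hg]
  rw [← hz1, ← hz0, ← hg1]
  refine hbound.trans ?_
  rcases eq_or_ne K 0 with h0 | h0
  · rw [h0, gronwallBound_K0]; simp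
  · rw [gronwallBound_of_K_ne_0 h0, div_self h0]; simp

/-- The determinant of `1 + (M - 1) P` does not depend on the window. -/
theorem twistDet_mono {F F' : Finset κ} (hF : F ⊆ F') (p : κ → κ → ℂ) {z : κ → ℂ}
    (hz : ∀ i ∈ F', i ∉ F → z i = 1) : twistDet F' p z = twistDet F p z := by
  -- With `A` the inclusion of coordinates, the two matrices are `1 + A B` and `1 + B A`, which have
  -- equal determinants.
  let A : Matrix F' F ℂ := Matrix.of fun i j => if (i : κ) = j then 1 else 0
  let B : Matrix F F' ℂ := Matrix.of fun i j => (z i - 1) * p i j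
  have h1 : twistMatrix F' p z = 1 + A * B := by
    unfold twistMatrix
    congr 1
    ext i j
    rw [Matrix.mul_apply]
    simp only [A, B, Matrix.of_apply, ite_mul, zero_mul, one_mul]
    by_cases hi : (i : κ) ∈ F
    · rw [Finset.sum_eq_single ⟨i, hi⟩]
      · simp
      · intro b _ hb
        rw [if_neg fun h => hb (Subtype.ext h.symm)]
      · simp
    · rw [hz i i.2 hi, sub_self, zero_mul, Finset.sum_eq_zero]
      intro b _
      rw [if_neg fun h : (i : κ) = b => hi (h ▸ b.2)]
  have h2 : twistMatrix F p z = 1 + B * A := by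
    unfold twistMatrix
    congr 1
    ext i j
    rw [Matrix.mul_apply]
    simp only [A, B, Matrix.of_apply, mul_ite, mul_zero, mul_one]
    rw [Finset.sum_eq_single ⟨j, hF j.2⟩]
    · simp
    · intro b _ hb
      rw [if_neg fun h => hb (Subtype.ext h)]
    · simp
  rw [twistDet, twistDet, h1, h2, Matrix.det_one_add_mul_comm]

end Determinant

/-! ### Polynomial approximation of functions of self-adjoint operators -/

/-- The commutator with `b` is a derivation, so the powers of `a` are handled by induction. The
constant depends only on `p` and `R`, which gives uniformity in `θ` later. -/
theorem norm_aeval_commutator_le {A : Type*} [NormedRing A] [NormedAlgebra ℝ A] (p : Polynomial ℝ)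
    (R : ℝ) : ∃ K : ℝ, 0 ≤ K ∧ ∀ a b : A, ‖a‖ ≤ R →
      ‖Polynomial.aeval a p * b - b * Polynomial.aeval a p‖ ≤ K * ‖a * b - b * a‖ := by
  induction p using Polynomial.induction_on' with
  | add p q hp hq =>
    obtain ⟨K, hK0, hK⟩ := hp
    obtain ⟨L, hL0, hL⟩ := hq
    refine ⟨K + L, add_nonneg hK0 hL0, fun a b ha => ?_⟩
    have e : Polynomial.aeval a (p + q) * b - b * Polynomial.aeval a (p + q)
        = (Polynomial.aeval a p * b - b * Polynomial.aeval a p)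
          + (Polynomial.aeval a q * b - b * Polynomial.aeval a q) := by
      rw [map_add]; noncomm_ring
    rw [e, add_mul]
    exact (norm_add_le _ _).trans (add_le_add (hK a b ha) (hL a b ha))
  | monomial n c =>
    have hpow : ∀ n : ℕ, ∃ B : ℝ, 0 ≤ B ∧ ∀ a : A, ‖a‖ ≤ R → ‖a ^ n‖ ≤ B := fun n => by
      induction n with
      | zero => exact ⟨‖(1 : A)‖, norm_nonneg _, fun a _ => by simp⟩
      | succ n ih =>
        obtain ⟨B, hB0, hB⟩ := ih
        refine ⟨B * |R|, by positivity, fun a ha => ?_⟩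
        rw [pow_succ]
        exact (norm_mul_le _ _).trans (mul_le_mul (hB a ha) (ha.trans (le_abs_self R))
          (norm_nonneg _) hB0)
    have hcomm : ∀ n : ℕ, ∃ K : ℝ, 0 ≤ K ∧ ∀ a b : A, ‖a‖ ≤ R →
        ‖a ^ n * b - b * a ^ n‖ ≤ K * ‖a * b - b * a‖ := fun n => by
      induction n with
      | zero => exact ⟨0, le_rfl, fun a b _ => by simp⟩
      | succ n ih =>
        obtain ⟨K, hK0, hK⟩ := ih
        obtain ⟨B, hB0, hB⟩ := hpow n
        refine ⟨B + K * |R|, by positivity, fun a b ha => ?_⟩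
        have e : a ^ (n + 1) * b - b * a ^ (n + 1)
            = a ^ n * (a * b - b * a) + (a ^ n * b - b * a ^ n) * a := by
          rw [pow_succ]; noncomm_ring
        rw [e, add_mul]
        refine (norm_add_le _ _).trans (add_le_add ?_ ?_)
        · exact (norm_mul_le _ _).trans (mul_le_mul_of_nonneg_right (hB a ha) (norm_nonneg _))
        · refine (norm_mul_le _ _).trans ?_
          calc _ ≤ (K * ‖a * b - b * a‖) * |R| :=
                mul_le_mul (hK a b ha) (ha.trans (le_abs_self R)) (norm_nonneg _) (by positivity)
            _ = _ := by ring
    obtain ⟨K, hK0, hK⟩ := hcomm n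
    refine ⟨|c| * K, by positivity, fun a b ha => ?_⟩
    rw [Polynomial.aeval_monomial, ← Algebra.smul_def, smul_mul_assoc, mul_smul_comm, ← smul_sub,
      norm_smul, Real.norm_eq_abs, mul_assoc]
    exact mul_le_mul_of_nonneg_left (hK a b ha) (abs_nonneg c)

section Operators

variable {E : Type*} [NormedAddCommGroup E] [InnerProductSpace ℂ E] [CompleteSpace E]

/-- The continuous functional calculus of bounded operators. -/
def opFun (g : ℝ → ℝ) (A : E →L[ℂ] E) : E →L[ℂ] E := cfc g A

/-- Weierstrass approximation on `[-R, R]`, which contains all the spectra in question; one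
polynomial serves every `A`. -/
theorem exists_polynomial_near_cfc {g : ℝ → ℝ} (hg : Continuous g) (R : ℝ) {ε : ℝ} (hε : 0 < ε) :
    ∃ p : Polynomial ℝ, ∀ A : E →L[ℂ] E, IsSelfAdjoint A → ‖A‖ ≤ R →
      ‖opFun g A - Polynomial.aeval A p‖ ≤ ε := by
  obtain ⟨p, hp⟩ := exists_polynomial_near_of_continuousOn (-R) R g hg.continuousOn ε hε
  refine ⟨p, fun A hA hR => ?_⟩
  rw [opFun, ← cfc_polynomial p A, ← cfc_sub g p.eval A hg.continuousOn p.continuous.continuousOn]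
  refine norm_cfc_le hε.le fun x hx => ?_
  have hx1 : ‖x‖ ≤ R := by
    rcases subsingleton_or_nontrivial (E →L[ℂ] E) with _ | _
    · simp [spectrum.of_subsingleton] at hx
    exact (spectrum.norm_le_norm_mul_of_mem hx).trans (by
      have : ‖(1 : E →L[ℂ] E)‖ ≤ 1 := ContinuousLinearMap.norm_id_le
      nlinarith [norm_nonneg A])
  rw [Real.norm_eq_abs] at hx1 ⊢
  rw [abs_sub_comm]
  exact (hp x (abs_le.1 hx1)).le

/-- Functions of `A` nearly commute with contractions nearly commuting with `A`. -/
theorem exists_norm_cfc_commutator_le {g : ℝ → ℝ} (hg : Continuous g) (R : ℝ) {ε : ℝ}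
    (hε : 0 < ε) : ∃ δ > 0, ∀ A M : E →L[ℂ] E, IsSelfAdjoint A → ‖A‖ ≤ R → ‖M‖ ≤ 1 →
      ‖A * M - M * A‖ ≤ δ → ‖opFun g A * M - M * opFun g A‖ ≤ ε := by
  -- The approximation error enters on both sides of the commutator, which uses `ε / 2`; the other
  -- half is left for the polynomial.
  obtain ⟨p, hp⟩ := exists_polynomial_near_cfc (E := E) hg R (ε := ε / 4) (by positivity)
  obtain ⟨K, hK0, hK⟩ := norm_aeval_commutator_le (A := E →L[ℂ] E) p R
  refine ⟨ε / 2 / (K + 1), by positivity, fun A M hA hR hM hc => ?_⟩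
  set Q := opFun g A
  set L := Polynomial.aeval A p
  have e : Q * M - M * Q = ((Q - L) * M - M * (Q - L)) + (L * M - M * L) := by noncomm_ring
  have h1 := hp A hA hR
  have h2 : ‖L * M - M * L‖ ≤ ε / 2 := by
    refine (hK A M hR).trans ?_
    calc K * ‖A * M - M * A‖ ≤ (K + 1) * (ε / 2 / (K + 1)) :=
          mul_le_mul (by linarith) hc (norm_nonneg _) (by positivity)
      _ = ε / 2 := by field_simp
  have h3 : ‖(Q - L) * M‖ ≤ ε / 4 * 1 :=
    (norm_mul_le _ _).trans (mul_le_mul h1 hM (norm_nonneg _) (by positivity))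
  have h4 : ‖M * (Q - L)‖ ≤ 1 * (ε / 4) :=
    (norm_mul_le _ _).trans (mul_le_mul hM h1 (norm_nonneg _) zero_le_one)
  rw [e]
  have h5 := norm_add_le ((Q - L) * M - M * (Q - L)) (L * M - M * L)
  have h6 := norm_sub_le ((Q - L) * M) (M * (Q - L))
  linarith

/-- The functional calculus respects intertwining contractions. -/
theorem cfc_intertwine {g : ℝ → ℝ} (hg : Continuous g) {A B S : E →L[ℂ] E} (hA : IsSelfAdjoint A)
    (hB : IsSelfAdjoint B) (h : B * S = S * A) : opFun g B * S = S * opFun g A := by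
  have hpoly : ∀ p : Polynomial ℝ, Polynomial.aeval B p * S = S * Polynomial.aeval A p := fun p => by
    have hpow : ∀ n : ℕ, B ^ n * S = S * A ^ n := fun n => by
      induction n with
      | zero => simp
      | succ n ih => rw [pow_succ, mul_assoc, h, ← mul_assoc, ih, mul_assoc, ← pow_succ]
    induction p using Polynomial.induction_on' with
    | add p q hp hq => rw [map_add, map_add, add_mul, mul_add, hp, hq]
    | monomial n c =>
      rw [Polynomial.aeval_monomial, Polynomial.aeval_monomial, ← Algebra.smul_def,
        ← Algebra.smul_def, smul_mul_assoc, mul_smul_comm, hpow]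
  rw [← sub_eq_zero, ← norm_le_zero_iff]
  refine le_of_forall_pos_le_add fun ε hε => ?_
  set δ := ε / (2 * (‖S‖ + 1)) with hδ
  have hδ0 : 0 < δ := by positivity
  obtain ⟨p, hp⟩ := exists_polynomial_near_cfc (E := E) hg (max ‖A‖ ‖B‖) hδ0
  have h1 := hp A hA (le_max_left _ _)
  have h2 := hp B hB (le_max_right _ _)
  have e : opFun g B * S - S * opFun g A = (opFun g B - Polynomial.aeval B p) * S
      - S * (opFun g A - Polynomial.aeval A p) := by
    rw [sub_mul, mul_sub, hpoly]; abel
  rw [e]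
  have h3 := norm_sub_le ((opFun g B - Polynomial.aeval B p) * S) (S * (opFun g A - Polynomial.aeval A p))
  have h4 : ‖(opFun g B - Polynomial.aeval B p) * S‖ ≤ δ * ‖S‖ :=
    (norm_mul_le _ _).trans (mul_le_mul_of_nonneg_right h2 (norm_nonneg _))
  have h5 : ‖S * (opFun g A - Polynomial.aeval A p)‖ ≤ ‖S‖ * δ :=
    (norm_mul_le _ _).trans (mul_le_mul_of_nonneg_left h1 (norm_nonneg _))
  have h6 : δ * ‖S‖ + ‖S‖ * δ ≤ ε := by
    have : δ * (2 * (‖S‖ + 1)) = ε := by rw [hδ]; field_simp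
    nlinarith
  linarith

/-- A bounded family of self-adjoint operators that is strongly continuous has a strongly
continuous functional calculus. -/
theorem continuous_cfc_apply {X : Type*} [TopologicalSpace X] {A : X → E →L[ℂ] E} {R : ℝ}
    (hA : ∀ x, IsSelfAdjoint (A x)) (hR : ∀ x, ‖A x‖ ≤ R) (hc : ∀ u, Continuous fun x => A x u)
    {g : ℝ → ℝ} (hg : Continuous g) (u : E) : Continuous fun x => opFun g (A x) u := by
  have hpoly : ∀ p : Polynomial ℝ, Continuous fun x => Polynomial.aeval (A x) p u := fun p => by
    -- Strong continuity passes to products only because the family is uniformly bounded.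
    have hvar : ∀ v : X → E, Continuous v → Continuous fun x => A x (v x) := fun v hv => by
      rw [continuous_iff_continuousAt]
      intro x₀
      have h0 : Tendsto (fun x => A x (v x - v x₀)) (𝓝 x₀) (𝓝 0) := by
        refine squeeze_zero_norm (a := fun x => R * ‖v x - v x₀‖) (fun x => ?_) ?_
        · exact ((A x).le_opNorm _).trans (mul_le_mul_of_nonneg_right (hR x) (norm_nonneg _))
        · have : Continuous fun x => R * ‖v x - v x₀‖ := by fun_prop
          have := this.tendsto x₀
          simpa using this
      have h1 := h0.add ((hc (v x₀)).tendsto x₀)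
      rw [zero_add] at h1
      refine h1.congr fun x => ?_
      rw [map_sub, sub_add_cancel]
    have hpow : ∀ n : ℕ, Continuous fun x => (A x ^ n) u := fun n => by
      induction n with
      | zero => simpa using continuous_const
      | succ n ih =>
        simp only [pow_succ']
        exact hvar _ ih
    induction p using Polynomial.induction_on' with
    | add p q hp hq =>
      simp only [map_add]
      exact hp.add hq
    | monomial n c =>
      simp only [Polynomial.aeval_monomial, ← Algebra.smul_def]
      exact (hpow n).const_smul c
  refine continuous_of_uniform_approx_of_continuous fun V hV => ?_
  obtain ⟨ε, hε, hεV⟩ := Metric.mem_uniformity_dist.1 hV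
  obtain ⟨p, hp⟩ := exists_polynomial_near_cfc (E := E) hg R (ε := ε / (2 * (‖u‖ + 1)))
    (by positivity)
  refine ⟨_, hpoly p, fun x => hεV ?_⟩
  rw [dist_eq_norm, ← sub_apply]
  refine (ContinuousLinearMap.le_opNorm _ _).trans_lt ?_
  calc _ ≤ ε / (2 * (‖u‖ + 1)) * ‖u‖ := mul_le_mul_of_nonneg_right (hp _ (hA x) (hR x)) (norm_nonneg _)
    _ < ε / (2 * (‖u‖ + 1)) * (2 * (‖u‖ + 1)) := by
      refine mul_lt_mul_of_pos_left ?_ (by positivity)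
      linarith [norm_nonneg u]
    _ = ε := by field_simp

/-- A self-adjoint operator has a spectral gap around `c` of radius `r` if and only if `A - c` is
bounded below by `r`. -/
theorem forall_mem_spectrum_iff {A : E →L[ℂ] E} (hA : IsSelfAdjoint A) (c : ℝ) {r : ℝ}
    (hr : 0 ≤ r) :
    (∀ x ∈ spectrum ℝ A, r ≤ |x - c|) ↔ ∀ u, r * ‖u‖ ≤ ‖A u - (c : ℂ) • u‖ := by
  -- Squaring turns the gap into positivity of `(A - c)² - r²`, whose quadratic form is `‖(A - c)
  -- u‖² - r² ‖u‖²`.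
  have h1 : (∀ x ∈ spectrum ℝ A, r ≤ |x - c|) ↔
      ∀ x ∈ spectrum ℝ A, 0 ≤ (x - c) * (x - c) - r ^ 2 := by
    refine forall₂_congr fun x _ => ?_
    rw [sub_nonneg, ← pow_two, sq_le_sq, abs_of_nonneg hr]
  rw [h1, ← cfc_nonneg_iff (fun x : ℝ => (x - c) * (x - c) - r ^ 2) A,
    ContinuousLinearMap.nonneg_iff_isPositive]
  have h2 : cfc (fun x : ℝ => x - c) A = A - algebraMap ℝ (E →L[ℂ] E) c := by
    rw [cfc_sub (fun x => x) (fun _ => c) A, cfc_id' ℝ A, cfc_const c A]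
  have h3 : cfc (fun x : ℝ => (x - c) * (x - c) - r ^ 2) A
      = (A - algebraMap ℝ (E →L[ℂ] E) c) * (A - algebraMap ℝ (E →L[ℂ] E) c)
        - algebraMap ℝ (E →L[ℂ] E) (r ^ 2) := by
    rw [cfc_sub (fun x => (x - c) * (x - c)) (fun _ => r ^ 2) A,
      cfc_mul (fun x => x - c) (fun x => x - c) A, cfc_const (r ^ 2) A, h2]
  have happ : ∀ (t : ℝ) (u : E), algebraMap ℝ (E →L[ℂ] E) t u = (t : ℂ) • u := fun t u => by
    rw [Algebra.algebraMap_eq_smul_one]; simp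
  set D := A - algebraMap ℝ (E →L[ℂ] E) c with hD
  have hDsa : IsSelfAdjoint D := by rw [← h2]; exact cfc_predicate _ A
  have hDu : ∀ u, D u = A u - (c : ℂ) • u := fun u => by
    rw [hD, sub_apply, happ]
  have h4 : ∀ u, (inner ℂ ((D * D - algebraMap ℝ (E →L[ℂ] E) (r ^ 2)) u) u).re
      = ‖D u‖ ^ 2 - (r * ‖u‖) ^ 2 := fun u => by
    have h5 : inner ℂ (D (D u)) u = inner ℂ (D u) (D u) := by
      rw [← ContinuousLinearMap.adjoint_inner_right, hDsa.adjoint_eq]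
    rw [sub_apply, happ, inner_sub_left, Complex.sub_re,
      mul_apply_eq_comp, h5, inner_smul_left, inner_self_eq_norm_sq_to_K,
      inner_self_eq_norm_sq_to_K, Complex.conj_ofReal]
    simp only [Complex.coe_algebraMap, ← Complex.ofReal_pow, ← Complex.ofReal_mul, Complex.ofReal_re]
    ring
  rw [h3]
  constructor
  · intro h u
    have h5 := h.re_inner_nonneg_left u
    rw [← hDu]
    change 0 ≤ (inner ℂ ((D * D - algebraMap ℝ (E →L[ℂ] E) (r ^ 2)) u) u).re at h5
    rw [h4, sub_nonneg] at h5
    exact le_of_sq_le_sq h5 (norm_nonneg _)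
  · intro h
    have hsa : IsSelfAdjoint (D * D - algebraMap ℝ (E →L[ℂ] E) (r ^ 2)) := by
      rw [← h3]; exact cfc_predicate _ A
    refine (ContinuousLinearMap.isPositive_def').2 ⟨hsa, fun u => ?_⟩
    change 0 ≤ (inner ℂ ((D * D - algebraMap ℝ (E →L[ℂ] E) (r ^ 2)) u) u).re
    rw [h4, sub_nonneg, hDu]
    exact pow_le_pow_left₀ (by positivity) (h u) 2

theorem isProj_cfc {A : E →L[ℂ] E} {g : ℝ → ℝ} (hg : Continuous g)
    (h : ∀ x ∈ spectrum ℝ A, g x = 0 ∨ g x = 1) (hA : IsSelfAdjoint A) : IsProj (opFun g A) := by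
  rw [opFun]
  have h1 : ‖cfc g A‖ ≤ 1 := norm_cfc_le zero_le_one fun x hx => by
    rcases h x hx with h | h <;> simp [h]
  have h2 : ‖1 - cfc g A‖ ≤ 1 := by
    have : cfc (fun x => 1 - g x) A = 1 - cfc g A := by
      rw [cfc_sub (fun _ => 1) g A, cfc_const_one ℝ A]
    rw [← this]
    exact norm_cfc_le zero_le_one fun x hx => by
      rcases h x hx with h | h <;> simp [h]
  refine ⟨fun x => ?_, fun x => ?_, fun x => ?_⟩
  · rw [← mul_apply_eq_comp, ← cfc_mul g g A]
    congr 1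
    refine cfc_congr fun x hx => ?_
    rcases h x hx with h | h <;> simp [h]
  · simpa using (cfc g A).le_of_opNorm_le h1 x
  · simpa using (1 - cfc g A).le_of_opNorm_le h2 x

end Operators

/-! ### Operators on `ℓ²(ℤ, ℂᵐ)` -/

section Sequences

variable {m : ℕ}

theorem hasSum_norm_sq (u : L2 m) : HasSum (fun n => ‖u n‖ ^ 2) (‖u‖ ^ 2) := by
  have := lp.hasSum_norm (p := 2) (by norm_num) u
  simpa using this

theorem sq_add_add_le {a b c : ℝ} (ha : 0 ≤ a) (hb : 0 ≤ b) (hc : 0 ≤ c) (x y z : ℝ) :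
    (a * x + b * y + c * z) ^ 2 ≤ (a + b + c) * (a * x ^ 2 + b * y ^ 2 + c * z ^ 2) := by
  have h1 := mul_nonneg (mul_nonneg ha hb) (sq_nonneg (x - y))
  have h2 := mul_nonneg (mul_nonneg ha hc) (sq_nonneg (x - z))
  have h3 := mul_nonneg (mul_nonneg hb hc) (sq_nonneg (y - z))
  linarith

/-- A Schur test for three-term recurrences: the weighted Cauchy–Schwarz inequality sitewise, then
summation using translation invariance. -/
theorem norm_le_of_forall_norm_le {u w : L2 m} {a b c : ℝ} (ha : 0 ≤ a) (hb : 0 ≤ b) (hc : 0 ≤ c)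
    (h : ∀ n, ‖w n‖ ≤ a * ‖u (n - 1)‖ + b * ‖u n‖ + c * ‖u (n + 1)‖) :
    ‖w‖ ≤ (a + b + c) * ‖u‖ := by
  have h0 := hasSum_norm_sq u
  have h1 : HasSum (fun n => ‖u (n - 1)‖ ^ 2) (‖u‖ ^ 2) :=
    ((Equiv.subRight (1 : ℤ)).hasSum_iff (f := fun n => ‖u n‖ ^ 2)).2 h0
  have h2 : HasSum (fun n => ‖u (n + 1)‖ ^ 2) (‖u‖ ^ 2) :=
    ((Equiv.addRight (1 : ℤ)).hasSum_iff (f := fun n => ‖u n‖ ^ 2)).2 h0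
  have h3 := (((h1.mul_left a).add (h0.mul_left b)).add (h2.mul_left c)).mul_left (a + b + c)
  have h4 : ‖w‖ ^ 2 ≤ (a + b + c) * (a * ‖u‖ ^ 2 + b * ‖u‖ ^ 2 + c * ‖u‖ ^ 2) :=
    hasSum_le (fun n => (pow_le_pow_left₀ (norm_nonneg _) (h n) 2).trans
      (sq_add_add_le ha hb hc _ _ _)) (hasSum_norm_sq w) h3
  refine le_of_sq_le_sq (h4.trans (le_of_eq ?_)) (by positivity)
  ring

/-- The translation `(S u)ₙ = uₙ₊₁`. -/
def translate (m : ℕ) : L2 m →L[ℂ] L2 m :=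
  LinearMap.mkContinuous
    { toFun := fun u => ⟨fun n => u (n + 1), memlp_comp_equiv u.2 (Equiv.addRight 1)⟩
      map_add' := fun u v => rfl
      map_smul' := fun c u => rfl }
    1 fun u => by
      have := norm_le_of_forall_norm_le (u := u)
        (w := ⟨fun n => u (n + 1), memlp_comp_equiv u.2 (Equiv.addRight 1)⟩) (a := 0) (b := 0)
        (c := 1) le_rfl le_rfl zero_le_one (fun n => by simp)
      rw [zero_add, zero_add] at this
      exact this

theorem translate_apply (u : L2 m) (n : ℤ) : translate m u n = u (n + 1) := rfl

theorem memlp_phase {z : ℤ → ℂ} (hz : ∀ n, ‖z n‖ = 1) (u : L2 m) :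
    Memℓp (fun n => z n • u n) 2 := by
  have hu : Memℓp (fun n => u n) 2 := u.2
  rw [memℓp_gen_iff (by norm_num)] at hu ⊢
  refine hu.congr fun n => ?_
  rw [norm_smul, hz, one_mul]

/-- The multiplication `(M u)ₙ = zₙ uₙ` by a sequence of complex numbers of modulus `1`. -/
def phaseMul {z : ℤ → ℂ} (hz : ∀ n, ‖z n‖ = 1) : L2 m →ₗᵢ[ℂ] L2 m where
  toFun u := ⟨fun n => z n • u n, memlp_phase hz u⟩
  map_add' u v := by ext1; funext n; exact smul_add _ _ _
  map_smul' c u := by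
    ext1
    funext n
    simp only [lp.coeFn_smul, Pi.smul_apply, RingHom.id_apply]
    exact smul_comm _ _ _
  norm_map' u := by
    have h1 := hasSum_norm_sq u
    have h2 := hasSum_norm_sq (m := m) ⟨fun n => z n • u n, memlp_phase hz u⟩
    have h3 : (fun n => ‖z n • u n‖ ^ 2) = fun n => ‖u n‖ ^ 2 := by
      funext n
      rw [norm_smul, hz, one_mul]
    have h4 := h2.unique (by rw [← h3] at h1; exact h1)
    exact (pow_left_inj₀ (norm_nonneg _) (norm_nonneg _) two_ne_zero).1 h4

theorem phaseMul_apply {z : ℤ → ℂ} (hz : ∀ n, ‖z n‖ = 1) (u : L2 m) (n : ℤ) :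
    phaseMul hz u n = z n • u n := rfl

/-- The standard basis of `ℓ²(ℤ, ℂᵐ)`. -/
def stdBasis (m : ℕ) (i : ℤ × Fin m) : L2 m := delta i.1 i.2

theorem inner_delta (n : ℤ) (i : Fin m) (u : L2 m) : inner ℂ (delta n i) u = u n i := by
  rw [delta, lp.inner_single_left, EuclideanSpace.inner_single_left]
  simp

theorem delta_apply (n k : ℤ) (i j : Fin m) :
    (delta n i : L2 m) k j = if k = n ∧ j = i then 1 else 0 := by
  rw [delta, lp.single_apply]
  by_cases h : k = n
  · subst h
    simp
  · simp [h]

theorem orthonormal_stdBasis : Orthonormal ℂ (stdBasis m) := by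
  rw [orthonormal_iff_ite]
  rintro ⟨n, i⟩ ⟨k, j⟩
  simp only [stdBasis, inner_delta, delta_apply, Prod.mk.injEq]

theorem translate_delta (n : ℤ) (i : Fin m) : translate m (delta (n + 1) i) = delta n i := by
  ext k j
  rw [translate_apply, delta_apply, delta_apply]
  simp

theorem phaseMul_eq_add_sum {z : ℤ → ℂ} (hz : ∀ n, ‖z n‖ = 1) {N : Finset ℤ}
    (hN : ∀ n ∉ N, z n = 1) (u : L2 m) :
    phaseMul hz u = u + ∑ i ∈ N ×ˢ (Finset.univ : Finset (Fin m)),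
      ((z i.1 - 1) * inner ℂ (stdBasis m i) u) • stdBasis m i := by
  ext n j
  have hsum : (∑ i ∈ N ×ˢ (Finset.univ : Finset (Fin m)),
      ((z i.1 - 1) * inner ℂ (stdBasis m i) u) • stdBasis m i : L2 m) n j
      = ∑ i ∈ N ×ˢ (Finset.univ : Finset (Fin m)),
        ((z i.1 - 1) * u i.1 i.2) * (if n = i.1 ∧ j = i.2 then 1 else 0) := by
    rw [← inner_delta, inner_sum]
    refine Finset.sum_congr rfl fun i _ => ?_
    rw [inner_smul_right, inner_delta, stdBasis, delta_apply, inner_delta]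
  have hadd : ∀ v : L2 m, (u + v) n j = u n j + v n j := fun v => rfl
  rw [hadd, hsum, phaseMul_apply]
  have hsm : (z n • u n) j = z n * u n j := rfl
  rw [hsm]
  by_cases hn : n ∈ N
  · rw [Finset.sum_eq_single (n, j)]
    · simp only [and_self, if_true]; ring
    · rintro ⟨k, l⟩ _ hne
      rw [if_neg, mul_zero]
      rintro ⟨rfl, rfl⟩
      exact hne rfl
    · intro h
      exact absurd (Finset.mem_product.2 ⟨hn, Finset.mem_univ j⟩) h
  · rw [hN n hn, Finset.sum_eq_zero]
    · ring
    · rintro ⟨k, l⟩ hk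
      rw [if_neg, mul_zero]
      rintro ⟨rfl, rfl⟩
      exact hn (Finset.mem_product.1 hk).1

variable {C : Matrix (Fin m) (Fin m) ℂ} {B : ℤ → Matrix (Fin m) (Fin m) ℂ}
  {hB : ∃ K : ℝ, ∀ n, ‖act (B n)‖ ≤ K}

theorem norm_blockJacobi_le {K : ℝ} (hK : ∀ n, ‖act (B n)‖ ≤ K) :
    ‖blockJacobi C B hB‖ ≤ ‖act C.conjTranspose‖ + K + ‖act C‖ := by
  have hK0 : 0 ≤ K := (norm_nonneg _).trans (hK 0)
  refine ContinuousLinearMap.opNorm_le_bound _ (by positivity) fun u => ?_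
  refine norm_le_of_forall_norm_le (norm_nonneg _) hK0 (norm_nonneg _) fun n => ?_
  rw [blockJacobi_apply]
  refine (norm_add₃_le).trans (add_le_add (add_le_add ?_ ?_) ?_)
  · exact (act C.conjTranspose).le_opNorm _
  · exact (act (B n)).le_of_opNorm_le (hK n) _
  · exact (act C).le_opNorm _

/-- The potential term commutes with scalars at each site, and the two hopping terms pick up the
differences of neighbouring phases. -/
theorem norm_commutator_phaseMul_le {z : ℤ → ℂ} (hz : ∀ n, ‖z n‖ = 1) {δ : ℝ}
    (hδ : ∀ n, ‖z n - z (n + 1)‖ ≤ δ) :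
    ‖blockJacobi C B hB * (phaseMul hz).toContinuousLinearMap
      - (phaseMul hz).toContinuousLinearMap * blockJacobi C B hB‖
      ≤ δ * (‖act C.conjTranspose‖ + ‖act C‖) := by
  have hδ0 : 0 ≤ δ := (norm_nonneg _).trans (hδ 0)
  refine ContinuousLinearMap.opNorm_le_bound _ (by positivity) fun u => ?_
  rw [show δ * (‖act C.conjTranspose‖ + ‖act C‖)
    = δ * ‖act C.conjTranspose‖ + 0 + δ * ‖act C‖ by ring]
  refine norm_le_of_forall_norm_le (by positivity) le_rfl (by positivity) fun n => ?_
  have e : ((blockJacobi C B hB * (phaseMul hz).toContinuousLinearMap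
      - (phaseMul hz).toContinuousLinearMap * blockJacobi C B hB : L2 m →L[ℂ] L2 m) u) n
      = (z (n - 1) - z n) • act C.conjTranspose (u (n - 1))
        + (z (n + 1) - z n) • act C (u (n + 1)) := by
    change (blockJacobi C B hB (phaseMul hz u)) n - (phaseMul hz (blockJacobi C B hB u)) n = _
    rw [blockJacobi_apply, phaseMul_apply hz u, phaseMul_apply hz u, phaseMul_apply hz u,
      phaseMul_apply hz _ n, blockJacobi_apply, map_smul, map_smul, map_smul]
    module
  rw [e, zero_mul, add_zero]
  refine (norm_add_le _ _).trans (add_le_add ?_ ?_)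
  · rw [norm_smul, mul_assoc]
    have := hδ (n - 1)
    rw [sub_add_cancel] at this
    exact mul_le_mul this ((act C.conjTranspose).le_opNorm _) (norm_nonneg _) hδ0
  · rw [norm_smul, mul_assoc, norm_sub_rev]
    exact mul_le_mul (hδ n) ((act C).le_opNorm _) (norm_nonneg _) hδ0

theorem inner_act_conjTranspose (A : Matrix (Fin m) (Fin m) ℂ) (x y : EuclideanSpace ℂ (Fin m)) :
    inner ℂ (act A.conjTranspose x) y = inner ℂ x (act A y) := by
  have : act A.conjTranspose = ContinuousLinearMap.adjoint (act A) := by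
    rw [← ContinuousLinearMap.star_eq_adjoint, ← map_star, Matrix.star_eq_conjTranspose]
  rw [this, ContinuousLinearMap.adjoint_inner_left]

theorem isSelfAdjoint_blockJacobi (hH : ∀ n, (B n).IsHermitian) :
    IsSelfAdjoint (blockJacobi C B hB) := by
  rw [ContinuousLinearMap.isSelfAdjoint_iff_isSymmetric]
  have hs : ∀ (A : Matrix (Fin m) (Fin m) ℂ) (u v : L2 m) (e : ℤ ≃ ℤ),
      Summable fun n => inner ℂ (u n) (act A (v (e n))) := fun A u v e =>
    lp.summable_inner u ⟨fun n => act A (v (e n)),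
      memlp_act (memlp_comp_equiv v.2 e) (fun _ => A) ⟨_, fun _ => le_rfl⟩⟩
  have hs' : ∀ (A : Matrix (Fin m) (Fin m) ℂ) (u v : L2 m) (e : ℤ ≃ ℤ),
      Summable fun n => inner ℂ (act A (u (e n))) (v n) := fun A u v e =>
    lp.summable_inner ⟨fun n => act A (u (e n)),
      memlp_act (memlp_comp_equiv u.2 e) (fun _ => A) ⟨_, fun _ => le_rfl⟩⟩ v
  have hd : ∀ u v : L2 m, Summable fun n => inner ℂ (u n) (act (B n) (v n)) := fun u v =>
    lp.summable_inner u ⟨fun n => act (B n) (v n), memlp_act v.2 B hB⟩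
  intro u v
  change inner ℂ (blockJacobi C B hB u) v = inner ℂ u (blockJacobi C B hB v)
  have hBn : ∀ n, inner ℂ (act (B n) (u n)) (v n) = inner ℂ (u n) (act (B n) (v n)) := fun n => by
    conv_lhs => rw [← (hH n).eq]
    exact inner_act_conjTranspose _ _ _
  have hC : ∀ x y : EuclideanSpace ℂ (Fin m),
      inner ℂ (act C x) y = inner ℂ x (act C.conjTranspose y) := fun x y => by
    conv_lhs => rw [← C.conjTranspose_conjTranspose]
    exact inner_act_conjTranspose _ _ _
  have hl := lp.hasSum_inner (𝕜 := ℂ) (blockJacobi C B hB u) v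
  have hr := lp.hasSum_inner (𝕜 := ℂ) u (blockJacobi C B hB v)
  have hl' := (((hs' C.conjTranspose u v (Equiv.subRight 1)).hasSum.add (hd u v).hasSum).add
    (hs' C u v (Equiv.addRight 1)).hasSum)
  have hr' := (((hs C.conjTranspose u v (Equiv.subRight 1)).hasSum.add (hd u v).hasSum).add
    (hs C u v (Equiv.addRight 1)).hasSum)
  have el : (fun n => inner ℂ ((blockJacobi C B hB u) n) (v n)) = fun n : ℤ =>
      inner ℂ (act C.conjTranspose (u (Equiv.subRight 1 n))) (v n)
        + inner ℂ (u n) (act (B n) (v n)) + inner ℂ (act C (u (Equiv.addRight 1 n))) (v n) := by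
    funext n
    rw [blockJacobi_apply, inner_add_left, inner_add_left, hBn]
    rfl
  have er : (fun n => inner ℂ (u n) ((blockJacobi C B hB v) n)) = fun n : ℤ =>
      inner ℂ (u n) (act C.conjTranspose (v (Equiv.subRight 1 n)))
        + inner ℂ (u n) (act (B n) (v n)) + inner ℂ (u n) (act C (v (Equiv.addRight 1 n))) := by
    funext n
    rw [blockJacobi_apply, inner_add_right, inner_add_right]
    rfl
  rw [el] at hl
  rw [er] at hr
  rw [hl.unique hl', hr.unique hr']
  -- Summation by shift exchanges the two hopping terms.
  have e1 : ∑' n : ℤ, inner ℂ (act C.conjTranspose (u (Equiv.subRight 1 n))) (v n)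
      = ∑' n : ℤ, inner ℂ (u n) (act C (v (Equiv.addRight 1 n))) := by
    rw [← (Equiv.addRight (1 : ℤ)).tsum_eq
      fun n => inner ℂ (act C.conjTranspose (u (Equiv.subRight 1 n))) (v n)]
    refine tsum_congr fun n => ?_
    rw [inner_act_conjTranspose]
    simp
  have e2 : ∑' n : ℤ, inner ℂ (act C (u (Equiv.addRight 1 n))) (v n)
      = ∑' n : ℤ, inner ℂ (u n) (act C.conjTranspose (v (Equiv.subRight 1 n))) := by
    rw [← (Equiv.subRight (1 : ℤ)).tsum_eq
      fun n => inner ℂ (act C (u (Equiv.addRight 1 n))) (v n)]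
    refine tsum_congr fun n => ?_
    rw [hC]
    simp
  rw [e1, e2]
  ring

end Sequences

/-! ### The family `H_θ`: strong continuity, covariance, slowly varying phases -/

theorem continuous_act_comp {Θ : Type*} [TopologicalSpace Θ] {m : ℕ}
    (f : C(Θ, Matrix (Fin m) (Fin m) ℂ)) :
    Continuous fun θ => act (f θ) :=
  (Matrix.toEuclideanCLM (n := Fin m)
    (𝕜 := ℂ)).toAlgEquiv.toLinearMap.continuous_of_finiteDimensional.comp f.continuous

section Family

variable {Θ : Type*} [TopologicalSpace Θ] [CompactSpace Θ] {m : ℕ} {T : Θ ≃ₜ Θ}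
  {C : Matrix (Fin m) (Fin m) ℂ} {f : C(Θ, Matrix (Fin m) (Fin m) ℂ)}

theorem exists_norm_act_le (f : C(Θ, Matrix (Fin m) (Fin m) ℂ)) : ∃ K : ℝ, ∀ θ, ‖act (f θ)‖ ≤ K := by
  obtain ⟨K, hK⟩ := (isCompact_range (continuous_act_comp f).norm).bddAbove
  exact ⟨K, fun θ => hK ⟨θ, rfl⟩⟩

variable (T C f) in
theorem exists_norm_schrodinger_le : ∃ R : ℝ, ∀ θ, ‖schrodinger T C f θ‖ ≤ R := by
  obtain ⟨K, hK⟩ := exists_norm_act_le f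
  exact ⟨_, fun θ => norm_blockJacobi_le fun n => hK _⟩

theorem isSelfAdjoint_schrodinger (hf : ∀ θ, (f θ).IsHermitian) (θ : Θ) :
    IsSelfAdjoint (schrodinger T C f θ) :=
  isSelfAdjoint_blockJacobi fun _ => hf _

/-- Each site of the potential is continuous in `θ`, but not uniformly in the site in general;
dominated convergence therefore gives strong continuity only. -/
theorem continuous_schrodinger_apply (u : L2 m) :
    Continuous fun θ => schrodinger T C f θ u := by
  obtain ⟨K, hK⟩ := exists_norm_act_le f
  rw [continuous_iff_continuousAt]
  intro θ₀
  rw [ContinuousAt, tendsto_iff_norm_sub_tendsto_zero]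
  have hsq : Tendsto (fun θ => ‖schrodinger T C f θ u - schrodinger T C f θ₀ u‖ ^ 2) (𝓝 θ₀)
      (𝓝 0) := by
    have h1 : ∀ θ, ‖schrodinger T C f θ u - schrodinger T C f θ₀ u‖ ^ 2
        = ∑' n : ℤ, ‖(act (f ((T ^ n) θ)) - act (f ((T ^ n) θ₀))) (u n)‖ ^ 2 := fun θ => by
      rw [← (hasSum_norm_sq _).tsum_eq]
      refine tsum_congr fun n => ?_
      congr 2
      change schrodinger T C f θ u n - schrodinger T C f θ₀ u n = _
      rw [schrodinger, schrodinger, blockJacobi_apply, blockJacobi_apply, sub_apply]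
      abel
    simp only [h1]
    have h0 : (0 : ℝ) = ∑' n : ℤ, (0 : ℝ) := by simp
    rw [h0]
    refine tendsto_tsum_of_dominated_convergence (bound := fun n => (K + K) ^ 2 * ‖u n‖ ^ 2)
      ((hasSum_norm_sq u).summable.mul_left _) (fun n => ?_) (Eventually.of_forall fun θ n => ?_)
    · have hc : Continuous fun θ => ‖(act (f ((T ^ n) θ)) - act (f ((T ^ n) θ₀))) (u n)‖ ^ 2 :=
        ((((continuous_act_comp f).comp (T ^ n).continuous).sub
          continuous_const).clm_apply continuous_const).norm.pow 2
      have := hc.tendsto θ₀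
      simpa using this
    · rw [Real.norm_of_nonneg (by positivity), ← mul_pow]
      refine pow_le_pow_left₀ (norm_nonneg _) ?_ 2
      refine (ContinuousLinearMap.le_opNorm _ _).trans (mul_le_mul_of_nonneg_right ?_ (norm_nonneg _))
      exact (norm_sub_le _ _).trans (add_le_add (hK _) (hK _))
  have := hsq.sqrt
  simpa using this

theorem schrodinger_translate (θ : Θ) :
    schrodinger T C f (T θ) * translate m = translate m * schrodinger T C f θ := by
  ext u n : 3
  change schrodinger T C f (T θ) (translate m u) n = schrodinger T C f θ u (n + 1)
  rw [schrodinger, schrodinger, blockJacobi_apply, blockJacobi_apply, translate_apply,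
    translate_apply, translate_apply, sub_add_cancel, add_sub_cancel_right]
  have : (T ^ n) (T θ) = (T ^ (n + 1)) θ := by rw [zpow_add, zpow_one, Homeomorph.mul_apply]
  rw [this]

theorem entry_translate (hf : ∀ θ, (f θ).IsHermitian) {g : ℝ → ℝ} (hg : Continuous g) (θ : Θ)
    (n k : ℤ) (i j : Fin m) :
    entry (stdBasis m) (opFun g (schrodinger T C f (T θ))) (n, i) (k, j)
      = entry (stdBasis m) (opFun g (schrodinger T C f θ)) (n + 1, i) (k + 1, j) := by
  have h := cfc_intertwine hg (isSelfAdjoint_schrodinger (T := T) (C := C) hf θ)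
    (isSelfAdjoint_schrodinger hf (T θ)) (schrodinger_translate θ)
  have h1 := congrArg (fun A : L2 m →L[ℂ] L2 m => A (delta (k + 1) j)) h
  simp only [mul_apply_eq_comp, translate_delta] at h1
  simp only [entry, stdBasis, inner_delta]
  rw [h1, translate_apply]

theorem exists_forall_almostCommutes (hf : ∀ θ, (f θ).IsHermitian) {g : ℝ → ℝ} (hg : Continuous g)
    {ε : ℝ} (hε : 0 < ε) :
    ∃ δ > 0, ∀ (θ : Θ) (q : ℤ → ℝ) (N : Finset ℤ), IsProj (opFun g (schrodinger T C f θ)) →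
      (∀ n, |q n - q (n + 1)| ≤ δ) →
      (∀ n ∉ N, Complex.exp (2 * Real.pi * Complex.I * q n) = 1) →
      AlmostCommutes (stdBasis m) (opFun g (schrodinger T C f θ))
        (N ×ˢ (Finset.univ : Finset (Fin m)))
        (fun i => Complex.exp (2 * Real.pi * Complex.I * q i.1)) ε := by
  obtain ⟨R, hR⟩ := exists_norm_schrodinger_le T C f
  obtain ⟨δ, hδ0, hδ⟩ := exists_norm_cfc_commutator_le (E := L2 m) hg R hε
  set W := ‖act C.conjTranspose‖ + ‖act C‖ with hW
  have hW0 : 0 ≤ W := by positivity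
  -- By `|e^{ix} - 1| ≤ |x|` such a slope moves neighbouring phases by at most `δ / (W + 1)`, and
  -- the commutator bound multiplies this by `W`.
  refine ⟨δ / (2 * Real.pi * (W + 1)), by positivity, fun θ q N hP hq hN => ?_⟩
  have hz : ∀ n, ‖Complex.exp (2 * Real.pi * Complex.I * q n)‖ = 1 := fun n => by
    rw [show (2 * Real.pi * Complex.I * q n : ℂ) = ((2 * Real.pi * q n : ℝ) : ℂ) * Complex.I by
      push_cast; ring]
    exact Complex.norm_exp_ofReal_mul_I _
  have hz2 : ∀ n, ‖Complex.exp (2 * Real.pi * Complex.I * q n)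
      - Complex.exp (2 * Real.pi * Complex.I * q (n + 1))‖ ≤ δ / (W + 1) := fun n => by
    have e : Complex.exp (2 * Real.pi * Complex.I * q n)
        - Complex.exp (2 * Real.pi * Complex.I * q (n + 1))
        = Complex.exp (2 * Real.pi * Complex.I * q (n + 1))
          * (Complex.exp (Complex.I * ((2 * Real.pi * (q n - q (n + 1)) : ℝ) : ℂ)) - 1) := by
      rw [mul_sub, ← Complex.exp_add, mul_one]
      congr 2
      push_cast
      ring
    rw [e, norm_mul, hz, one_mul]
    refine (Real.norm_exp_I_mul_ofReal_sub_one_le).trans ?_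
    rw [Real.norm_eq_abs, abs_mul, abs_of_pos Real.two_pi_pos]
    calc _ ≤ 2 * Real.pi * (δ / (2 * Real.pi * (W + 1))) :=
          mul_le_mul_of_nonneg_left (hq n) Real.two_pi_pos.le
      _ = _ := by field_simp
  set M := (phaseMul (m := m) hz).toContinuousLinearMap
  refine ⟨M, fun x => (phaseMul hz).norm_map x, fun x => phaseMul_eq_add_sum hz hN x, fun x => ?_⟩
  have hM1 : ‖M‖ ≤ 1 := ContinuousLinearMap.opNorm_le_bound _ zero_le_one fun x => by
    rw [one_mul]; exact ((phaseMul hz).norm_map x).le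
  have hcomm := hδ _ M (isSelfAdjoint_schrodinger (T := T) (C := C) hf θ) (hR θ) hM1 (by
    refine (norm_commutator_phaseMul_le hz hz2).trans ?_
    rw [← hW, div_mul_eq_mul_div, div_le_iff₀ (by positivity)]
    nlinarith)
  set P := opFun g (schrodinger T C f θ)
  -- Idempotence turns the failure of `M` to preserve the range of `P` into a commutator.
  have e : M (P x) - P (M (P x)) = -((P * M - M * P) (P x)) := by
    rw [sub_apply, mul_apply_eq_comp, mul_apply_eq_comp, hP.idem]
    abel
  rw [e, norm_neg]
  exact (ContinuousLinearMap.le_of_opNorm_le _ hcomm _).trans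
    (mul_le_mul_of_nonneg_left (hP.norm_le x) hε.le)

end Family

/-! ### Spectral measures and the integrated density of states -/

section SpectralMeasure

variable {E : Type*} [NormedAddCommGroup E] [InnerProductSpace ℂ E] [CompleteSpace E]

instance regular_spectralMeasure (A : E →L[ℂ] E) (v : E) : (spectralMeasure A v).Regular :=
  RealRMK.regular_rieszMeasure _

theorem isCompact_spectrum_real (A : E →L[ℂ] E) : IsCompact (spectrum ℝ A) :=
  spectrum.isCompact (𝕜 := ℝ) A

/-- By inner regularity it suffices to treat compact sets off the spectrum. A Urysohn function that
is `1` there and `0` on the spectrum has zero functional calculus. -/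
theorem spectralMeasure_compl_spectrum (A : E →L[ℂ] E) (v : E) :
    spectralMeasure A v (spectrum ℝ A)ᶜ = 0 := by
  have hcl := (isCompact_spectrum_real A).isClosed
  rw [hcl.isOpen_compl.measure_eq_iSup_isCompact]
  simp only [ENNReal.iSup_eq_zero]
  intro K hKs hK
  obtain ⟨f, hf1, hf0, hfc, hf⟩ := exists_continuous_one_zero_of_isCompact hK hcl
    (disjoint_left.2 fun x hx hx' => hKs hx hx')
  have h1 := RealRMK.rieszMeasure_le_of_eq_one (spectralFunctional A v) (f := ⟨f, hfc⟩)
    (fun x => (hf x).1) hK (fun x hx => hf1 hx)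
  have h2 : spectralFunctional A v ⟨f, hfc⟩ = 0 := by
    change (inner ℂ v (cfc (fun x : ℝ => f x) A v)).re = 0
    have : cfc (fun x : ℝ => f x) A = cfc (fun _ : ℝ => (0 : ℝ)) A :=
      cfc_congr fun x hx => hf0 hx
    rw [this, cfc_const_zero]
    simp
  rw [h2, ENNReal.ofReal_zero] at h1
  exact le_antisymm h1 zero_le

theorem ae_mem_spectrum (A : E →L[ℂ] E) (v : E) :
    ∀ᵐ x ∂(spectralMeasure A v), x ∈ spectrum ℝ A :=
  spectralMeasure_compl_spectrum A v

instance isFiniteMeasure_spectralMeasure (A : E →L[ℂ] E) (v : E) :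
    IsFiniteMeasure (spectralMeasure A v) := by
  constructor
  have h1 := measure_union_le (μ := spectralMeasure A v) (spectrum ℝ A) (spectrum ℝ A)ᶜ
  rw [union_compl_self, spectralMeasure_compl_spectrum, add_zero] at h1
  exact h1.trans_lt (isCompact_spectrum_real A).measure_lt_top

/-- Multiplying `g` by a compactly supported function equal to `1` on the spectrum changes neither
side. -/
theorem integral_spectralMeasure_of_continuous {A : E →L[ℂ] E} (v : E) {g : ℝ → ℝ}
    (hg : Continuous g) :
    ∫ x, g x ∂(spectralMeasure A v) = (inner ℂ v (opFun g A v)).re := by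
  obtain ⟨f, hf1, -, hfc, hf⟩ := exists_continuous_one_zero_of_isCompact
    (isCompact_spectrum_real A) isClosed_empty (disjoint_empty _)
  let G : C_c(ℝ, ℝ) := ⟨⟨fun x => g x * f x, hg.mul f.continuous⟩, hfc.mul_left⟩
  have hG : ∀ x ∈ spectrum ℝ A, G x = g x := fun x hx => by
    change g x * f x = g x
    rw [hf1 hx]
    simp
  have h := integral_spectralMeasure A v G
  have h1 : ∫ x, G x ∂(spectralMeasure A v) = ∫ x, g x ∂(spectralMeasure A v) := by
    refine integral_congr_ae ?_
    filter_upwards [ae_mem_spectrum A v] with x hx using hG x hx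
  have h2 : cfc (fun x : ℝ => G x) A = opFun g A := cfc_congr fun x hx => hG x hx
  rw [← h1, h, h2]

theorem spectralMeasure_real_eq {A : E →L[ℂ] E} (v : E) {g : ℝ → ℝ} (hg : Continuous g)
    {s : Set ℝ} (hs : MeasurableSet s) (h : ∀ x ∈ spectrum ℝ A, g x = s.indicator 1 x) :
    (spectralMeasure A v).real s = (inner ℂ v (opFun g A v)).re := by
  rw [← integral_indicator_one hs, ← integral_spectralMeasure_of_continuous v hg]
  refine integral_congr_ae ?_
  filter_upwards [ae_mem_spectrum A v] with x hx using (h x hx).symm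

theorem spectralMeasure_real_univ {A : E →L[ℂ] E} (hA : IsSelfAdjoint A) (v : E) :
    (spectralMeasure A v).real univ = ‖v‖ ^ 2 := by
  rw [spectralMeasure_real_eq v (g := fun _ => 1) continuous_const MeasurableSet.univ
    (fun x _ => by simp), opFun, cfc_const_one ℝ A, one_apply_eq_self, inner_self_eq_norm_sq_to_K]
  norm_cast

theorem measurable_spectralMeasure {X : Type*} [TopologicalSpace X] [MeasurableSpace X]
    [OpensMeasurableSpace X] {A : X → E →L[ℂ] E} {R : ℝ} (hA : ∀ x, IsSelfAdjoint (A x))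
    (hR : ∀ x, ‖A x‖ ≤ R) (hc : ∀ u, Continuous fun x => A x u) (v : E) :
    Measurable fun x => spectralMeasure (A x) v := by
  have hint : ∀ g : ℝ → ℝ, Continuous g →
      Measurable fun x => ∫ t, g t ∂(spectralMeasure (A x) v) := fun g hg => by
    simp only [integral_spectralMeasure_of_continuous v hg]
    exact (Complex.continuous_re.comp
      (continuous_const.inner (continuous_cfc_apply hA hR hc hg v))).measurable
  have hofReal : ∀ s, Measurable (fun x => (spectralMeasure (A x) v).real s) →
      Measurable fun x => spectralMeasure (A x) v s := fun s hs => by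
    have : (fun x => spectralMeasure (A x) v s)
        = fun x => ENNReal.ofReal ((spectralMeasure (A x) v).real s) := by
      funext x
      rw [ofReal_measureReal]
    rw [this]
    exact hs.ennreal_ofReal
  refine Measurable.measure_of_isPiSystem (borel_eq_generateFrom_Iic ℝ ▸ BorelSpace.measurable_eq)
    isPiSystem_Iic ?_ ?_
  · rintro _ ⟨a, rfl⟩
    refine hofReal _ ?_
    -- Ramps that are `1` up to `a` and fall with slope `-k` to `0` converge to the indicator of
    -- `(-∞, a]`; their integrals depend continuously on the parameter.
    refine measurable_of_tendsto_metrizable (f := fun (k : ℕ) x =>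
      ∫ t, max 0 (min 1 (1 - k * (t - a))) ∂(spectralMeasure (A x) v))
      (fun k => hint _ (by fun_prop)) ?_
    rw [tendsto_pi_nhds]
    intro x
    rw [← integral_indicator_one measurableSet_Iic]
    refine tendsto_integral_of_dominated_convergence (fun _ => 1)
      (fun k => (Continuous.aestronglyMeasurable (by fun_prop))) (integrable_const _)
      (fun k => Eventually.of_forall fun t => ?_) (Eventually.of_forall fun t => ?_)
    · rw [Real.norm_of_nonneg (le_max_left _ _)]
      exact max_le zero_le_one (min_le_left _ _)
    · by_cases ht : t ≤ a
      · refine tendsto_const_nhds.congr fun k => ?_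
        have : (k : ℝ) * (t - a) ≤ 0 :=
          mul_nonpos_of_nonneg_of_nonpos k.cast_nonneg (by linarith)
        rw [min_eq_left (by linarith), indicator_of_mem (mem_Iic.2 ht)]
        simp
      · rw [indicator_of_notMem (by simpa using ht)]
        refine tendsto_const_nhds.congr' ?_
        have h0 : 0 < t - a := by linarith
        filter_upwards [tendsto_natCast_atTop_atTop.eventually_ge_atTop (1 / (t - a))] with k hk
        rw [div_le_iff₀ h0] at hk
        rw [min_eq_right (by nlinarith), max_eq_left (by linarith)]
  · refine hofReal _ ?_
    simp only [spectralMeasure_real_univ (hA _)]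
    exact measurable_const

end SpectralMeasure

/-! ### The integrated density of states as a mean local trace -/

section IDS

variable {Θ : Type*} [TopologicalSpace Θ] [CompactSpace Θ] [MeasurableSpace Θ] [BorelSpace Θ]
  {μ : Measure Θ} {m : ℕ} {T : Θ ≃ₜ Θ}
  {C : Matrix (Fin m) (Fin m) ℂ} {f : C(Θ, Matrix (Fin m) (Fin m) ℂ)}

theorem measurable_spectralMeasure_schrodinger (hf : ∀ θ, (f θ).IsHermitian) (v : L2 m) :
    Measurable fun θ => spectralMeasure (schrodinger T C f θ) v := by
  obtain ⟨R, hR⟩ := exists_norm_schrodinger_le T C f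
  exact measurable_spectralMeasure (isSelfAdjoint_schrodinger hf) hR continuous_schrodinger_apply v

theorem mul_ids_eq_integral (hm : 0 < m) (hf : ∀ θ, (f θ).IsHermitian) (E : ℝ) :
    (m : ℝ) * ids μ T C f E
      = ∫ θ, ∑ i : Fin m, (spectralMeasure (schrodinger T C f θ) (delta 0 i)).real (Iic E) ∂μ := by
  have hmeas := fun i : Fin m => measurable_spectralMeasure_schrodinger (T := T) (C := C) hf
    (delta 0 i)
  have happ : ∀ (θ : Θ) (s : Set ℝ), ((m : ℝ≥0∞)⁻¹ • ∑ i : Fin m,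
      spectralMeasure (schrodinger T C f θ) (delta 0 i)) s
      = (m : ℝ≥0∞)⁻¹ * ∑ i : Fin m, spectralMeasure (schrodinger T C f θ) (delta 0 i) s :=
    fun θ s => by rw [Measure.smul_apply, Measure.finsetSum_apply, smul_eq_mul]
  have hsm : ∀ s, MeasurableSet s → Measurable fun θ =>
      ∑ i : Fin m, spectralMeasure (schrodinger T C f θ) (delta 0 i) s := fun s hs =>
    Finset.measurable_fun_sum _ fun i _ => (Measure.measurable_coe hs).comp (hmeas i)
  have hker : Measurable fun θ => (m : ℝ≥0∞)⁻¹ • ∑ i : Fin m,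
      spectralMeasure (schrodinger T C f θ) (delta 0 i) := by
    refine Measure.measurable_of_measurable_coe _ fun s hs => ?_
    simp only [happ]
    exact (hsm s hs).const_mul _
  have hm0 : (m : ℝ≥0∞) ≠ 0 := by exact_mod_cast hm.ne'
  rw [ids, Measure.real, densityOfStates, Measure.bind_apply measurableSet_Iic hker.aemeasurable]
  simp only [happ]
  rw [lintegral_const_mul _ (hsm _ measurableSet_Iic), ENNReal.toReal_mul, ENNReal.toReal_inv,
    ENNReal.toReal_natCast, mul_inv_cancel_left₀ (by exact_mod_cast hm.ne')]
  rw [integral_eq_lintegral_of_nonneg_ae (Eventually.of_forall fun θ =>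
    Finset.sum_nonneg fun i _ => measureReal_nonneg)]
  · congr 1
    refine lintegral_congr fun θ => ?_
    rw [ENNReal.ofReal_sum_of_nonneg fun i _ => measureReal_nonneg]
    exact Finset.sum_congr rfl fun i _ => (ofReal_measureReal).symm
  · refine Measurable.aestronglyMeasurable (Finset.measurable_fun_sum _ fun i _ => ?_)
    exact ((Measure.measurable_coe measurableSet_Iic).comp (hmeas i)).ennreal_toReal

theorem mul_ids_mem_Icc [IsProbabilityMeasure μ] (hm : 0 < m) (hf : ∀ θ, (f θ).IsHermitian) (E : ℝ) :
    (m : ℝ) * ids μ T C f E ∈ Icc (0 : ℝ) m := by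
  refine ⟨mul_nonneg m.cast_nonneg measureReal_nonneg, ?_⟩
  rw [mul_ids_eq_integral hm hf]
  have h1 : ∀ θ, ∑ i : Fin m, (spectralMeasure (schrodinger T C f θ) (delta 0 i)).real (Iic E)
      ≤ m := fun θ => by
    have h2 : ∀ i : Fin m,
        (spectralMeasure (schrodinger T C f θ) (delta 0 i)).real (Iic E) ≤ 1 := fun i => by
      refine (measureReal_mono (subset_univ _)).trans ?_
      have h3 : ‖(delta 0 i : L2 m)‖ = 1 := orthonormal_stdBasis.1 (0, i)
      rw [spectralMeasure_real_univ (isSelfAdjoint_schrodinger hf θ), h3, one_pow]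
    refine (Finset.sum_le_sum fun i _ => h2 i).trans ?_
    simp
  refine (integral_mono_of_nonneg (g := fun _ => (m : ℝ)) (Eventually.of_forall fun θ =>
    Finset.sum_nonneg fun i _ => measureReal_nonneg) (integrable_const _)
    (Eventually.of_forall h1)).trans ?_
  simp

/-- In a gap the discontinuous spectral projection is a continuous function of `H_θ`, whose entries
are continuous in `θ`. -/
theorem mul_ids_eq_integral_entry (hm : 0 < m) (hf : ∀ θ, (f θ).IsHermitian) {E : ℝ} {g : ℝ → ℝ}
    (hg : Continuous g)
    (h : ∀ θ, ∀ x ∈ spectrum ℝ (schrodinger T C f θ), g x = (Iic E).indicator 1 x) :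
    (m : ℝ) * ids μ T C f E = ∫ θ, ∑ i : Fin m,
      (entry (stdBasis m) (opFun g (schrodinger T C f θ)) (0, i) (0, i)).re ∂μ := by
  rw [mul_ids_eq_integral hm hf]
  refine integral_congr_ae (Eventually.of_forall fun θ => Finset.sum_congr rfl fun i _ => ?_)
  exact spectralMeasure_real_eq (delta 0 i) hg measurableSet_Iic (h θ)

end IDS

/-! ### Spectral gaps and the almost sure spectrum -/

theorem norm_translate {m : ℕ} (u : L2 m) : ‖translate m u‖ = ‖u‖ := by
  have h1 := hasSum_norm_sq (translate m u)
  have h2 : HasSum (fun n => ‖translate m u n‖ ^ 2) (‖u‖ ^ 2) :=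
    ((Equiv.addRight (1 : ℤ)).hasSum_iff (f := fun n => ‖u n‖ ^ 2)).2 (hasSum_norm_sq u)
  exact (pow_left_inj₀ (norm_nonneg _) (norm_nonneg _) two_ne_zero).1 (h1.unique h2)

theorem translate_surjective (m : ℕ) : Function.Surjective (translate m) := fun u =>
  ⟨⟨fun n => u (n - 1), memlp_comp_equiv u.2 (Equiv.subRight 1)⟩, by
    ext1
    funext n
    rw [translate_apply]
    change u (n + 1 - 1) = u n
    rw [add_sub_cancel_right]⟩

section Gap

variable {Θ : Type*} [TopologicalSpace Θ] [CompactSpace Θ] {m : ℕ} {T : Θ ≃ₜ Θ}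
  {C : Matrix (Fin m) (Fin m) ℂ} {f : C(Θ, Matrix (Fin m) (Fin m) ℂ)}

variable (T C f) in
/-- The set of all `θ` such that `H_θ - c` is bounded below by `r`. -/
def gapSet (c r : ℝ) : Set Θ :=
  {θ | ∀ u, r * ‖u‖ ≤ ‖schrodinger T C f θ u - (c : ℂ) • u‖}

theorem mem_gapSet_iff (hf : ∀ θ, (f θ).IsHermitian) {c r : ℝ} (hr : 0 ≤ r) (θ : Θ) :
    θ ∈ gapSet T C f c r ↔ ∀ x ∈ spectrum ℝ (schrodinger T C f θ), r ≤ |x - c| :=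
  (forall_mem_spectrum_iff (isSelfAdjoint_schrodinger hf θ) c hr).symm

theorem isClosed_gapSet (c r : ℝ) : IsClosed (gapSet T C f c r) := by
  have : gapSet T C f c r
      = ⋂ u, {θ | r * ‖u‖ ≤ ‖schrodinger T C f θ u - (c : ℂ) • u‖} := by
    ext θ; simp [gapSet]
  rw [this]
  exact isClosed_iInter fun u => isClosed_le continuous_const
    ((continuous_schrodinger_apply u).sub continuous_const).norm

/-- Translation is a surjective isometry intertwining `H_θ` with `H_{Tθ}`. -/
theorem preimage_gapSet (c r : ℝ) : T ⁻¹' gapSet T C f c r = gapSet T C f c r := by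
  have key : ∀ (θ : Θ) (v : L2 m), ‖schrodinger T C f (T θ) (translate m v)
      - (c : ℂ) • translate m v‖ = ‖schrodinger T C f θ v - (c : ℂ) • v‖ := fun θ v => by
    have h := congrArg (fun A : L2 m →L[ℂ] L2 m => A v) (schrodinger_translate (T := T) (C := C)
      (f := f) θ)
    simp only [mul_apply_eq_comp] at h
    rw [h, ← map_smul, ← map_sub, norm_translate]
  ext θ
  constructor
  · intro h u
    have := h (translate m u)
    rwa [key, norm_translate] at this
  · intro h u
    obtain ⟨v, rfl⟩ := translate_surjective m u
    rw [key, norm_translate]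
    exact h v

theorem spectrum_real_eq {θ : Θ} {S : Set ℝ}
    (h : spectrum ℂ (schrodinger T C f θ) = (fun x : ℝ => (x : ℂ)) '' S) :
    spectrum ℝ (schrodinger T C f θ) = S := by
  rw [← spectrum.preimage_algebraMap (S := ℂ), h]
  exact preimage_image_eq S Complex.ofReal_injective

theorem spectrum_complex_eq (hf : ∀ θ, (f θ).IsHermitian) (θ : Θ) :
    spectrum ℂ (schrodinger T C f θ)
      = (fun x : ℝ => (x : ℂ)) '' spectrum ℝ (schrodinger T C f θ) :=
  ((isSelfAdjoint_schrodinger hf θ).spectrumRestricts.algebraMap_image).symm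

variable [MeasurableSpace Θ] {μ : Measure Θ}

/-- Gaps with rational centre and radius determine a closed spectrum. Each is a closed invariant
event, so by ergodicity it is null or of full measure, and there are countably many. -/
theorem exists_isAlmostSureSpectrum [BorelSpace Θ] [IsProbabilityMeasure μ] (hT : Ergodic T μ) (hf : ∀ θ, (f θ).IsHermitian) :
    ∃ S, IsAlmostSureSpectrum μ T C f S := by
  set S : Set ℝ := {x | ∀ p : ℚ × ℚ, 0 < p.2 → |x - p.1| < p.2 →
    ¬ ∀ᵐ θ ∂μ, θ ∈ gapSet T C f p.1 p.2} with hS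
  have h1 : ∀ᵐ θ ∂μ, ∀ p : ℚ × ℚ, θ ∈ gapSet T C f p.1 p.2 ↔
      ∀ᵐ θ ∂μ, θ ∈ gapSet T C f p.1 p.2 := by
    rw [ae_all_iff]
    intro p
    rcases hT.ae_mem_or_ae_notMem (isClosed_gapSet (T := T) (C := C) (f := f) p.1 p.2).measurableSet
      (preimage_gapSet _ _) with h | h
    · filter_upwards [h] with θ hθ using ⟨fun _ => h, fun _ => hθ⟩
    · filter_upwards [h] with θ hθ
      refine ⟨fun h' => absurd h' hθ, fun h' => ?_⟩
      obtain ⟨θ', h3, h4⟩ := (h'.and h).exists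
      exact absurd h3 h4
  have h2 : ∀ θ, (∀ p : ℚ × ℚ, θ ∈ gapSet T C f p.1 p.2 ↔
      ∀ᵐ θ ∂μ, θ ∈ gapSet T C f p.1 p.2) → spectrum ℝ (schrodinger T C f θ) = S := by
    intro θ hθ
    ext x
    constructor
    · intro hx p hp0 hp hae
      have := (mem_gapSet_iff hf (by exact_mod_cast hp0.le) θ).1 ((hθ p).2 hae) x hx
      linarith
    · intro hx
      by_contra hx'
      obtain ⟨ε, hε, hball⟩ := Metric.isOpen_iff.1
        (isCompact_spectrum_real (schrodinger T C f θ)).isClosed.isOpen_compl x hx'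
      -- With `r < ε / 2` and the centre within `r` of `x`, the rational interval contains `x` and
      -- stays inside the `ε`-ball.
      obtain ⟨r, hr0, hr⟩ := exists_rat_btwn (half_pos hε)
      have hr0' : 0 < r := by exact_mod_cast hr0
      obtain ⟨c, hc1, hc2⟩ := exists_rat_btwn (show x - r < x by linarith)
      refine hx (c, r) hr0' (by rw [abs_lt]; constructor <;> linarith) ?_
      rw [← hθ (c, r), mem_gapSet_iff hf hr0.le]
      intro y hy
      by_contra hlt
      rw [not_le, abs_lt] at hlt
      refine hball (Metric.mem_ball.2 ?_) hy
      rw [Real.dist_eq, abs_lt]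
      constructor <;> linarith
  refine ⟨S, ?_, ?_⟩
  · obtain ⟨θ, hθ⟩ := h1.exists
    rw [← h2 θ hθ]
    exact isCompact_spectrum_real _
  · filter_upwards [h1] with θ hθ
    rw [spectrum_complex_eq hf, h2 θ hθ]

/-- A point off the almost sure spectrum lies in a gap of all operators of the family, uniformly. -/
theorem exists_forall_gap (hμ : μ.support = univ) (hf : ∀ θ, (f θ).IsHermitian) {S : Set ℝ}
    (hS : IsAlmostSureSpectrum μ T C f S) {E : ℝ} (hE : E ∉ S) :
    ∃ r > 0, ∀ θ, ∀ x ∈ spectrum ℝ (schrodinger T C f θ), r ≤ |x - E| := by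
  obtain ⟨r, hr, hball⟩ := Metric.isOpen_iff.1 hS.1.isClosed.isOpen_compl E hE
  refine ⟨r, hr, fun θ => (mem_gapSet_iff hf hr.le θ).1 ?_⟩
  have hae : gapSet T C f E r ∈ ae μ := by
    filter_upwards [hS.2] with θ hθ
    rw [mem_gapSet_iff hf hr.le, spectrum_real_eq hθ]
    intro x hx
    by_contra hlt
    exact hball (Metric.mem_ball.2 (not_le.1 hlt)) hx
  -- A closed set of full measure contains the support, so the almost sure gap holds for every `θ`.
  have := Measure.support_subset_of_isClosed (isClosed_gapSet E r) hae
  rw [hμ] at this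
  exact this (mem_univ θ)

end Gap

/-! ### Phases of nonvanishing functions -/

/-- The phase `arg z / 2π` of a complex number, modulo `1`. -/
def circlePhase (z : ℂ) : UnitAddCircle :=
  AddCircle.equivAddCircle (2 * Real.pi) 1 Real.two_pi_pos.ne' one_ne_zero (z.arg : Real.Angle)

theorem continuousAt_circlePhase {z : ℂ} (hz : z ≠ 0) : ContinuousAt circlePhase z :=
  (AddCircle.homeomorphAddCircle (2 * Real.pi) 1 Real.two_pi_pos.ne'
    one_ne_zero).continuous.continuousAt.comp (Complex.continuousAt_arg_coe_angle hz)

theorem circlePhase_mul {z w : ℂ} (hz : z ≠ 0) (hw : w ≠ 0) :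
    circlePhase (z * w) = circlePhase z + circlePhase w := by
  rw [circlePhase, Complex.arg_mul_coe_angle hz hw]
  exact map_add (AddCircle.equivAddCircle (2 * Real.pi) 1 Real.two_pi_pos.ne' one_ne_zero) _ _

/-- A representative of the phase. -/
def turn (z : ℂ) : ℝ := z.arg / (2 * Real.pi)

theorem equivAddCircle_coe (x : ℝ) : AddCircle.equivAddCircle (2 * Real.pi) 1 Real.two_pi_pos.ne'
    one_ne_zero ((x : Real.Angle) : AddCircle (2 * Real.pi)) = ((x / (2 * Real.pi) : ℝ) : UnitAddCircle) := by
  have h := AddCircle.equivAddCircle_apply_mk (2 * Real.pi) 1 Real.two_pi_pos.ne' one_ne_zero x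
  rw [mul_one, ← div_eq_mul_inv] at h
  exact h

theorem circlePhase_eq_turn (z : ℂ) : circlePhase z = (turn z : UnitAddCircle) :=
  equivAddCircle_coe _

theorem circlePhase_exp (t : ℝ) :
    circlePhase (Complex.exp (2 * Real.pi * Complex.I * t)) = (t : UnitAddCircle) := by
  have h : ((Complex.exp (2 * Real.pi * Complex.I * t)).arg : Real.Angle)
      = ((2 * Real.pi * t : ℝ) : Real.Angle) := by
    rw [← Complex.arg_cos_add_sin_mul_I_coe_angle ((2 * Real.pi * t : ℝ) : Real.Angle)]
    congr 2
    rw [Real.Angle.cos_coe, Real.Angle.sin_coe, Complex.ofReal_cos, Complex.ofReal_sin,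
      ← Complex.exp_mul_I]
    congr 1
    push_cast
    ring
  rw [circlePhase, h]
  refine (equivAddCircle_coe _).trans ?_
  congr 1
  field_simp

theorem abs_turn_le {z : ℂ} {η : ℝ} (hη : η ≤ 1 / 2) (hz : ‖z - 1‖ ≤ η) : |turn z| ≤ η := by
  have h1 := Complex.norm_log_one_add_half_le_self (hz.trans hη)
  rw [add_sub_cancel] at h1
  have h2 : |z.arg| ≤ ‖Complex.log z‖ := by
    rw [← Complex.log_im]
    exact Complex.abs_im_le_norm _
  rw [turn, abs_div, abs_of_pos Real.two_pi_pos, div_le_iff₀ Real.two_pi_pos]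
  have h3 := norm_nonneg (z - 1)
  nlinarith [Real.pi_gt_three]

theorem continuousAt_turn {z : ℂ} (hz : ‖z - 1‖ < 1) : ContinuousAt turn z := by
  refine (Complex.continuousAt_arg ?_).div_const _
  left
  have h1 := (Complex.abs_re_le_norm (z - 1)).trans_lt hz
  rw [Complex.sub_re, Complex.one_re, abs_lt] at h1
  linarith

/-- An approximate exponential ratio becomes an exact cocycle relation, with the error kept as a
small real number. -/
theorem circlePhase_eq_add {w w' : ℂ} (hw : w ≠ 0) (hw' : w' ≠ 0) (t : ℝ) :
    circlePhase w' = circlePhase w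
      + ((t + turn (w' / w * Complex.exp (-(2 * Real.pi * Complex.I * t))) : ℝ) : UnitAddCircle) := by
  set ξ := w' / w * Complex.exp (-(2 * Real.pi * Complex.I * t)) with hξ
  have hξ0 : ξ ≠ 0 := mul_ne_zero (div_ne_zero hw' hw) (Complex.exp_ne_zero _)
  have e : w' = w * (Complex.exp (2 * Real.pi * Complex.I * t) * ξ) := by
    rw [hξ, Complex.exp_neg]
    field_simp [Complex.exp_ne_zero]
  conv_lhs => rw [e]
  rw [circlePhase_mul hw (mul_ne_zero (Complex.exp_ne_zero _) hξ0),
    circlePhase_mul (Complex.exp_ne_zero _) hξ0, circlePhase_exp, circlePhase_eq_turn ξ,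
    AddCircle.coe_add]

theorem eq_zero_of_coe_eq_zero {x : ℝ} (h : (x : UnitAddCircle) = 0) (hx : |x| < 1) : x = 0 := by
  obtain ⟨n, hn⟩ := (AddCircle.coe_eq_zero_iff 1).1 h
  rw [zsmul_eq_mul, mul_one] at hn
  rw [← hn] at hx ⊢
  have : |n| < 1 := by exact_mod_cast hx
  rw [Int.abs_lt_one_iff.1 this, Int.cast_zero]

/-- Let `w_L` be nonvanishing functions such that the phases of `w_L ∘ T / w_L` and of
`w_{L+1} / w_L` are asymptotic to real functions `A_L` and `G_L` with
`G_L ∘ T - G_L = A_{L+1} - A_L`. Then the common integral of the functions `A_L` belongs to the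
Schwartzman group. -/
theorem mem_schwartzmanGroup_of_asymptotic {Θ : Type*} [MetricSpace Θ] [CompactSpace Θ]
    [MeasurableSpace Θ] [BorelSpace Θ] {μ : Measure Θ} [IsProbabilityMeasure μ] {T : Θ ≃ₜ Θ}
    (hT : Ergodic T μ) {w : ℕ → Θ → ℂ} {A G : ℕ → C(Θ, ℝ)} {a : ℝ}
    (hG : ∀ L θ, G L (T θ) - G L θ = A (L + 1) θ - A L θ)
    (h : ∀ η > 0, ∃ L₀, ∀ L ≥ L₀, Continuous (w L) ∧ (∀ θ, w L θ ≠ 0) ∧ ∫ θ, A L θ ∂μ = a ∧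
      (∀ θ, ‖w L (T θ) / w L θ * Complex.exp (-(2 * Real.pi * Complex.I * A L θ)) - 1‖ ≤ η) ∧
      ∀ θ, ‖w (L + 1) θ / w L θ * Complex.exp (-(2 * Real.pi * Complex.I * G L θ)) - 1‖ ≤ η) :
    a ∈ schwartzmanGroup T μ := by
  set e : ℕ → Θ → ℝ := fun L θ =>
    turn (w L (T θ) / w L θ * Complex.exp (-(2 * Real.pi * Complex.I * A L θ))) with he
  set e' : ℕ → Θ → ℝ := fun L θ =>
    turn (w (L + 1) θ / w L θ * Complex.exp (-(2 * Real.pi * Complex.I * G L θ))) with he'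
  -- Four such errors add up to at most `1/2 < 1`, which is what excludes a nonzero integer below.
  obtain ⟨L₀, hL₀⟩ := h (1 / 8) (by norm_num)
  have hcont : ∀ L ≥ L₀, Continuous (e L) := fun L hL => by
    obtain ⟨h1, h2, -, h4, -⟩ := hL₀ L hL
    rw [continuous_iff_continuousAt]
    intro θ
    have hc : Continuous fun θ => w L (T θ) / w L θ *
        Complex.exp (-(2 * Real.pi * Complex.I * A L θ)) := by
      refine ((h1.comp T.continuous).div h1 h2).mul (Complex.continuous_exp.comp ?_)
      fun_prop
    exact ContinuousAt.comp (f := fun θ => w L (T θ) / w L θ *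
        Complex.exp (-(2 * Real.pi * Complex.I * A L θ)))
      (continuousAt_turn ((h4 θ).trans_lt (by norm_num))) hc.continuousAt
  have hcont' : ∀ L ≥ L₀, Continuous (e' L) := fun L hL => by
    obtain ⟨h1, h2, -, -, h4⟩ := hL₀ L hL
    have h1' := (hL₀ (L + 1) (by omega)).1
    rw [continuous_iff_continuousAt]
    intro θ
    have hc : Continuous fun θ => w (L + 1) θ / w L θ *
        Complex.exp (-(2 * Real.pi * Complex.I * G L θ)) := by
      refine (h1'.div h1 h2).mul (Complex.continuous_exp.comp ?_)
      fun_prop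
    exact ContinuousAt.comp (f := fun θ => w (L + 1) θ / w L θ *
        Complex.exp (-(2 * Real.pi * Complex.I * G L θ)))
      (continuousAt_turn ((h4 θ).trans_lt (by norm_num))) hc.continuousAt
  have hint : ∀ g : Θ → ℝ, Continuous g → Integrable g μ := fun g hg =>
    hg.integrable_of_hasCompactSupport (HasCompactSupport.of_compactSpace g)
  have hmem : ∀ L ≥ L₀, a + ∫ θ, e L θ ∂μ ∈ schwartzmanGroup T μ := fun L hL => by
    obtain ⟨h1, h2, h3, -, -⟩ := hL₀ L hL
    have := integral_mem_schwartzmanGroup hT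
      ⟨fun θ => circlePhase (w L θ), continuous_iff_continuousAt.2 fun θ =>
        ContinuousAt.comp (f := w L) (continuousAt_circlePhase (h2 θ)) h1.continuousAt⟩
      (A L + ⟨e L, hcont L hL⟩) (fun θ => circlePhase_eq_add (h2 θ) (h2 (T θ)) (A L θ))
    rw [← h3, ← integral_add (hint _ (A L).continuous) (hint _ (hcont L hL))]
    exact this
  have hstep : ∀ L ≥ L₀, ∫ θ, e (L + 1) θ ∂μ = ∫ θ, e L θ ∂μ := fun L hL => by
    obtain ⟨-, h2, -, h4, h5⟩ := hL₀ L hL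
    obtain ⟨-, k2, -, k4, -⟩ := hL₀ (L + 1) (by omega)
    -- Passing from `w_L(θ)` to `w_{L+1}(Tθ)` through `w_{L+1}(θ)` or through `w_L(Tθ)` gives the
    -- same phase, and the main terms cancel by `hG`.
    have key : ∀ θ, e (L + 1) θ - e L θ = e' L (T θ) - e' L θ := fun θ => by
      have c1 := circlePhase_eq_add (k2 θ) (k2 (T θ)) (A (L + 1) θ)
      have c2 := circlePhase_eq_add (h2 θ) (h2 (T θ)) (A L θ)
      have c3 := circlePhase_eq_add (h2 θ) (k2 θ) (G L θ)
      have c4 := circlePhase_eq_add (h2 (T θ)) (k2 (T θ)) (G L (T θ))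
      have b1 := abs_le.1 (abs_turn_le (by norm_num) (k4 θ))
      have b2 := abs_le.1 (abs_turn_le (by norm_num) (h4 θ))
      have b3 := abs_le.1 (abs_turn_le (by norm_num) (h5 θ))
      have b4 := abs_le.1 (abs_turn_le (by norm_num) (h5 (T θ)))
      have hc : ((e (L + 1) θ - e L θ - (e' L (T θ) - e' L θ) : ℝ) : UnitAddCircle) = 0 := by
        have hx : e (L + 1) θ - e L θ - (e' L (T θ) - e' L θ)
            = (A (L + 1) θ + e (L + 1) θ) - (A L θ + e L θ) - (G L (T θ) + e' L (T θ))
              + (G L θ + e' L θ) := by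
          linarith [hG L θ]
        rw [hx, AddCircle.coe_add, AddCircle.coe_sub, AddCircle.coe_sub,
          ← sub_eq_iff_eq_add'.2 c1, ← sub_eq_iff_eq_add'.2 c2, ← sub_eq_iff_eq_add'.2 c3,
          ← sub_eq_iff_eq_add'.2 c4]
        abel
      have := eq_zero_of_coe_eq_zero hc (by
        rw [abs_lt]
        constructor <;> simp only [he, he'] <;> linarith)
      linarith
    have hcomp : ∫ θ, e' L (T θ) ∂μ = ∫ θ, e' L θ ∂μ :=
      hT.toMeasurePreserving.integral_comp T.measurableEmbedding _
    have h6 : ∫ θ, (e (L + 1) θ - e L θ) ∂μ = 0 := by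
      simp only [key]
      rw [integral_sub (f := fun θ => e' L (T θ)) (hint _ ((hcont' L hL).comp T.continuous)) (hint _ (hcont' L hL)), hcomp,
        sub_self]
    rw [integral_sub (hint _ (hcont _ (by omega))) (hint _ (hcont L hL))] at h6
    linarith
  have hconst : ∀ L ≥ L₀, ∫ θ, e L θ ∂μ = ∫ θ, e L₀ θ ∂μ := fun L hL => by
    induction L, hL using Nat.le_induction with
    | base => rfl
    | succ L hL ih => rw [hstep L hL, ih]
  -- The integral does not depend on `L`, while `e L` tends uniformly to `0`.
  have hzero : ∫ θ, e L₀ θ ∂μ = 0 := by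
    rw [← norm_le_zero_iff]
    refine le_of_forall_pos_le_add fun η hη => ?_
    obtain ⟨L₁, hL₁⟩ := h (min η (1 / 2)) (by positivity)
    obtain ⟨-, -, -, h4, -⟩ := hL₁ (max L₀ L₁) (le_max_right _ _)
    rw [← hconst (max L₀ L₁) (le_max_left _ _), zero_add]
    have := norm_integral_le_of_norm_le_const (μ := μ) (C := η) (f := e (max L₀ L₁))
      (Eventually.of_forall fun θ =>
        (abs_turn_le (min_le_right _ _) (h4 θ)).trans (min_le_left _ _))
    simpa using this
  have := hmem L₀ le_rfl
  rwa [hzero, add_zero] at this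

/-! ### Slowly varying cutoffs -/

/-- The window `{0, …, L + 1}`. -/
def window (L : ℕ) : Finset ℤ := Finset.Icc 0 (L + 1)

/-- The cutoff function that decreases linearly from `1` at `0` to `0` at `L`. -/
def cutoff (L : ℕ) (n : ℤ) : ℝ := max 0 (min 1 (1 - n / L))

theorem cutoff_of_nonpos (L : ℕ) {n : ℤ} (hn : n ≤ 0) : cutoff L n = 1 := by
  have h1 : (n : ℝ) / L ≤ 0 := div_nonpos_of_nonpos_of_nonneg (by exact_mod_cast hn) L.cast_nonneg
  rw [cutoff, min_eq_left (by linarith)]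
  simp

theorem cutoff_of_le {L : ℕ} (hL : 0 < L) {n : ℤ} (hn : (L : ℤ) ≤ n) : cutoff L n = 0 := by
  have h0 : (0 : ℝ) < L := by exact_mod_cast hL
  have h1 : (1 : ℝ) ≤ (n : ℝ) / L := by
    rw [le_div_iff₀ h0, one_mul]
    exact_mod_cast hn
  rw [cutoff, max_eq_left]
  exact (min_le_right _ _).trans (by linarith)

theorem abs_clamp_sub_le (x y : ℝ) : |max 0 (min 1 x) - max 0 (min 1 y)| ≤ |x - y| := by
  refine (abs_max_sub_max_le_max 0 _ 0 _).trans (max_le (by simp) ?_)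
  exact (abs_min_sub_min_le_max 1 x 1 y).trans (max_le (by simp) le_rfl)

theorem abs_cutoff_sub_succ_le (L : ℕ) (n : ℤ) : |cutoff L n - cutoff L (n + 1)| ≤ 1 / L := by
  refine (abs_clamp_sub_le _ _).trans (le_of_eq ?_)
  rw [show (1 - (n : ℝ) / L) - (1 - ((n + 1 : ℤ) : ℝ) / L) = 1 / L by push_cast; ring]
  exact abs_of_nonneg (by positivity)

/-- Before clamping, the difference is `n / (L (L + 1))`. -/
theorem abs_cutoff_succ_sub_le {L : ℕ} (hL : 0 < L) {n : ℤ} (h0 : 0 ≤ n) (h1 : n ≤ L + 1) :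
    |cutoff (L + 1) n - cutoff L n| ≤ 1 / L := by
  refine (abs_clamp_sub_le _ _).trans ?_
  have hL' : (0 : ℝ) < L := by exact_mod_cast hL
  have h0' : (0 : ℝ) ≤ n := by exact_mod_cast h0
  have h1' : (n : ℝ) ≤ L + 1 := by exact_mod_cast h1
  rw [show (1 - (n : ℝ) / (L + 1 : ℕ)) - (1 - (n : ℝ) / L) = (n / (L + 1)) / L by
    push_cast; field_simp; ring]
  rw [abs_of_nonneg (by positivity)]
  exact div_le_div_of_nonneg_right ((div_le_one (by positivity)).2 h1') hL'.le

theorem card_window (L : ℕ) : (window L).card = L + 2 := by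
  rw [window, Int.card_Icc]
  omega

theorem notMem_window {L : ℕ} {n : ℤ} (h : n ∉ window L) : n < 0 ∨ (L : ℤ) + 1 < n := by
  rw [window, Finset.mem_Icc] at h
  omega

theorem sum_window_sub (L : ℕ) (F : ℤ → ℝ) :
    ∑ n ∈ window L, (F (n - 1) - F n) = F (-1) - F (L + 1) := by
  have h1 : ∀ K : ℕ, ∑ n ∈ Finset.Icc (0 : ℤ) K, (F (n - 1) - F n) = F (-1) - F K := fun K => by
    induction K with
    | zero => simp
    | succ K ih =>
      have : Finset.Icc (0 : ℤ) (K + 1 : ℕ) = insert ((K : ℤ) + 1) (Finset.Icc (0 : ℤ) K) := by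
        ext x
        simp only [Finset.mem_Icc, Finset.mem_insert]
        push_cast
        omega
      rw [this, Finset.sum_insert (by simp), ih, add_sub_cancel_right]
      push_cast
      ring
  have := h1 (L + 1)
  push_cast at this
  exact this

/-! ### Weighted sums of local traces; reindexing of determinants -/

section Pairing

variable {Θ : Type*}

/-- The finite sum `∑ₙ Dₙ ρₙ(θ)`. -/
def pairing (D : ℤ → ℝ) (ρ : ℤ → Θ → ℝ) (θ : Θ) : ℝ := ∑' n, D n * ρ n θ

theorem pairing_eq_sum {D : ℤ → ℝ} {N : Finset ℤ} (hD : ∀ n ∉ N, D n = 0) (ρ : ℤ → Θ → ℝ) (θ : Θ) :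
    pairing D ρ θ = ∑ n ∈ N, D n * ρ n θ :=
  tsum_eq_sum fun n hn => by rw [hD n hn, zero_mul]

theorem pairing_sub {D D' : ℤ → ℝ} {N : Finset ℤ} (hD : ∀ n ∉ N, D n = 0) (hD' : ∀ n ∉ N, D' n = 0)
    (ρ : ℤ → Θ → ℝ) (θ : Θ) :
    pairing (fun n => D n - D' n) ρ θ = pairing D ρ θ - pairing D' ρ θ := by
  rw [pairing_eq_sum hD, pairing_eq_sum hD', pairing_eq_sum (N := N), ← Finset.sum_sub_distrib]
  · exact Finset.sum_congr rfl fun n _ => by ring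
  · intro n hn
    rw [hD n hn, hD' n hn, sub_zero]

theorem pairing_comp {T : Θ → Θ} {ρ : ℤ → Θ → ℝ} (hρ : ∀ n θ, ρ n (T θ) = ρ (n + 1) θ) (D : ℤ → ℝ)
    (θ : Θ) : pairing D ρ (T θ) = pairing (fun n => D (n - 1)) ρ θ := by
  rw [pairing, pairing, ← (Equiv.addRight (1 : ℤ)).tsum_eq fun n => D (n - 1) * ρ n θ]
  refine tsum_congr fun n => ?_
  rw [hρ]
  simp

theorem continuous_pairing [TopologicalSpace Θ] {D : ℤ → ℝ} {N : Finset ℤ} (hD : ∀ n ∉ N, D n = 0)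
    {ρ : ℤ → Θ → ℝ} (hρ : ∀ n, Continuous (ρ n)) : Continuous (pairing D ρ) := by
  have : pairing D ρ = fun θ => ∑ n ∈ N, D n * ρ n θ := by
    funext θ
    exact pairing_eq_sum hD ρ θ
  rw [this]
  exact continuous_finsetSum _ fun n _ => (hρ n).const_mul _

end Pairing

theorem twistDet_map {κ : Type*} [DecidableEq κ] (σ : κ ↪ κ) (F : Finset κ) (p : κ → κ → ℂ)
    (z : κ → ℂ) :
    twistDet (F.map σ) p z = twistDet F (fun i j => p (σ i) (σ j)) (fun i => z (σ i)) := by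
  let e : F ≃ F.map σ := Equiv.ofBijective (fun i => ⟨σ i, Finset.mem_map_of_mem σ i.2⟩)
    ⟨fun i j h => Subtype.ext (σ.injective (congrArg Subtype.val h)), fun ⟨j, hj⟩ => by
      obtain ⟨i, hi, rfl⟩ := Finset.mem_map.1 hj
      exact ⟨⟨i, hi⟩, rfl⟩⟩
  have : twistMatrix F (fun i j => p (σ i) (σ j)) (fun i => z (σ i))
      = (twistMatrix (F.map σ) p z).submatrix e e := by
    ext i j
    simp only [twistMatrix, Matrix.add_apply, Matrix.of_apply, Matrix.submatrix_apply, Matrix.one_apply,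
      e.injective.eq_iff]
    rfl
  rw [twistDet, twistDet, this, Matrix.det_submatrix_equiv_self]

theorem continuous_twistDet {Θ : Type*} [TopologicalSpace Θ] {κ : Type*} [DecidableEq κ]
    (F : Finset κ) {p : Θ → κ → κ → ℂ} (hp : ∀ i j, Continuous fun θ => p θ i j) (z : κ → ℂ) :
    Continuous fun θ => twistDet F (p θ) z := by
  refine Continuous.matrix_det (continuous_matrix fun i j => ?_)
  simp only [twistMatrix, Matrix.add_apply, Matrix.of_apply]
  exact continuous_const.add (continuous_const.mul (hp i j))

/-! ### The gap labelling theorem -/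

section Main

variable {Θ : Type*} [MetricSpace Θ] [CompactSpace Θ] {m : ℕ} {T : Θ ≃ₜ Θ}
  {C : Matrix (Fin m) (Fin m) ℂ} {f : C(Θ, Matrix (Fin m) (Fin m) ℂ)} {g : ℝ → ℝ}

variable (T C f g) in
/-- The matrix entries of `g(H_θ)`. -/
def projEntry (θ : Θ) (i j : ℤ × Fin m) : ℂ :=
  entry (stdBasis m) (opFun g (schrodinger T C f θ)) i j

variable (T C f g) in
/-- The trace of the `n`-th diagonal block of `g(H_θ)`. -/
def siteTrace (n : ℤ) (θ : Θ) : ℝ := ∑ i : Fin m, (projEntry T C f g θ (n, i) (n, i)).re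

/-- The phases `e^{2πi q(n)}`. -/
def sitePhase (q : ℤ → ℝ) (i : ℤ × Fin m) : ℂ := Complex.exp (2 * Real.pi * Complex.I * q i.1)

variable (T C f g) in
/-- The determinant of `1 + (e^{2πi q} - 1) g(H_θ)` for the cutoff function `q` of length `L`. -/
def cutoffDet (L : ℕ) (θ : Θ) : ℂ :=
  twistDet (window L ×ˢ (Finset.univ : Finset (Fin m))) (projEntry T C f g θ) (sitePhase (cutoff L))

theorem continuous_projEntry (hf : ∀ θ, (f θ).IsHermitian) (hg : Continuous g) (i j : ℤ × Fin m) :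
    Continuous fun θ => projEntry T C f g θ i j := by
  obtain ⟨R, hR⟩ := exists_norm_schrodinger_le T C f
  exact continuous_const.inner
    (continuous_cfc_apply (isSelfAdjoint_schrodinger hf) hR continuous_schrodinger_apply hg _)

theorem continuous_siteTrace (hf : ∀ θ, (f θ).IsHermitian) (hg : Continuous g) (n : ℤ) :
    Continuous (siteTrace T C f g n) :=
  continuous_finsetSum _ fun _ _ => Complex.continuous_re.comp (continuous_projEntry hf hg _ _)

theorem projEntry_apply_T (hf : ∀ θ, (f θ).IsHermitian) (hg : Continuous g) (θ : Θ)
    (i j : ℤ × Fin m) :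
    projEntry T C f g (T θ) i j = projEntry T C f g θ (i.1 + 1, i.2) (j.1 + 1, j.2) :=
  entry_translate hf hg θ i.1 j.1 i.2 j.2

theorem siteTrace_apply_T (hf : ∀ θ, (f θ).IsHermitian) (hg : Continuous g) (n : ℤ) (θ : Θ) :
    siteTrace T C f g n (T θ) = siteTrace T C f g (n + 1) θ := by
  simp only [siteTrace, projEntry_apply_T hf hg]

theorem projEntry_self (θ : Θ) (i : ℤ × Fin m) :
    ((projEntry T C f g θ i i).re : ℂ) = projEntry T C f g θ i i := by
  have h : IsSelfAdjoint (opFun g (schrodinger T C f θ)) := cfc_predicate _ _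
  rw [projEntry, entry, ← Complex.conj_eq_iff_re, inner_conj_symm]
  conv_lhs => rw [← h.adjoint_eq]
  exact ContinuousLinearMap.adjoint_inner_left _ _ _

theorem sum_projEntry (D : ℤ → ℝ) {N : Finset ℤ} (hD : ∀ n ∉ N, D n = 0) (θ : Θ) :
    ∑ i ∈ N ×ˢ (Finset.univ : Finset (Fin m)), (D i.1 : ℂ) * projEntry T C f g θ i i
      = (pairing D (siteTrace T C f g) θ : ℝ) := by
  rw [pairing_eq_sum hD, Finset.sum_product, Complex.ofReal_sum]
  refine Finset.sum_congr rfl fun n _ => ?_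
  rw [siteTrace, Complex.ofReal_mul, Complex.ofReal_sum, Finset.mul_sum]
  exact Finset.sum_congr rfl fun i _ => by rw [projEntry_self]

theorem sitePhase_eq_one {q : ℤ → ℝ} {i : ℤ × Fin m} (h : q i.1 = 0 ∨ q i.1 = 1) :
    sitePhase q i = 1 := by
  rcases h with h | h
  · simp [sitePhase, h]
  · simp [sitePhase, h, Complex.exp_two_pi_mul_I]

/-- The determinant does not depend on the window, as long as it is large enough. -/
theorem cutoffDet_eq {L : ℕ} (hL : 0 < L) {N : Finset ℤ} (hN : Finset.Icc 1 (L : ℤ) ⊆ N) (θ : Θ) :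
    twistDet (N ×ˢ (Finset.univ : Finset (Fin m))) (projEntry T C f g θ) (sitePhase (cutoff L))
      = cutoffDet T C f g L θ := by
  have h1 : ∀ N : Finset ℤ, Finset.Icc 1 (L : ℤ) ⊆ N →
      twistDet (N ×ˢ (Finset.univ : Finset (Fin m))) (projEntry T C f g θ) (sitePhase (cutoff L))
      = twistDet (Finset.Icc 1 (L : ℤ) ×ˢ (Finset.univ : Finset (Fin m))) (projEntry T C f g θ)
        (sitePhase (cutoff L)) := fun N hN => by
    refine twistDet_mono (Finset.product_subset_product hN subset_rfl) _ fun i _ hi => ?_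
    refine sitePhase_eq_one ?_
    have h2 : i.1 < 1 ∨ (L : ℤ) < i.1 := by
      by_contra h3
      refine hi (Finset.mem_product.2 ⟨Finset.mem_Icc.2 ?_, Finset.mem_univ _⟩)
      omega
    rcases h2 with h2 | h2
    · exact Or.inr (cutoff_of_nonpos L (by omega))
    · exact Or.inl (cutoff_of_le hL (by omega))
  rw [cutoffDet, h1 N hN, h1 (window L)]
  intro n hn
  rw [window, Finset.mem_Icc]
  rw [Finset.mem_Icc] at hn
  omega

/-- Covariance trades `T` for a shift of the indices. The shift carries `{-1, …, L}` to the window,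
and the determinant does not notice the change of window. -/
theorem cutoffDet_apply_T (hf : ∀ θ, (f θ).IsHermitian) (hg : Continuous g) {L : ℕ} (hL : 0 < L)
    (θ : Θ) :
    twistDet (window L ×ˢ (Finset.univ : Finset (Fin m))) (projEntry T C f g θ)
      (sitePhase fun n => cutoff L (n - 1)) = cutoffDet T C f g L (T θ) := by
  let σ : (ℤ × Fin m) ↪ (ℤ × Fin m) :=
    ((Equiv.addRight (1 : ℤ)).prodCongr (Equiv.refl (Fin m))).toEmbedding
  have h1 : window L ×ˢ (Finset.univ : Finset (Fin m))
      = (Finset.Icc (-1) (L : ℤ) ×ˢ (Finset.univ : Finset (Fin m))).map σ := by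
    ext ⟨n, i⟩
    simp only [window, Finset.mem_product, Finset.mem_Icc, Finset.mem_univ, and_true,
      Finset.mem_map, Prod.exists, σ, Equiv.coe_toEmbedding, Equiv.prodCongr_apply, Prod.map_apply,
      Equiv.coe_addRight, Equiv.refl_apply, Prod.mk.injEq, exists_eq_right_right]
    constructor
    · intro h
      exact ⟨n - 1, ⟨by omega, by omega⟩, by omega⟩
    · rintro ⟨k, h2, rfl⟩
      omega
  rw [h1, twistDet_map, ← cutoffDet_eq hL (N := Finset.Icc (-1) (L : ℤ))]
  · congr 1
    · funext i j
      exact (projEntry_apply_T hf hg θ i j).symm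
    · funext i
      simp [sitePhase, σ]
  · exact Finset.Icc_subset_Icc (by norm_num) le_rfl

/-- Comparison of the determinants for two slowly varying cutoffs. -/
theorem exists_forall_twistDet_ratio (hf : ∀ θ, (f θ).IsHermitian) (hg : Continuous g)
    (hP : ∀ θ, IsProj (opFun g (schrodinger T C f θ))) {η : ℝ} (hη : 0 < η) :
    ∃ δ > 0, ∀ (q q' : ℤ → ℝ) (L : ℕ), 0 < L → (∀ n, |q n - q (n + 1)| ≤ δ) →
      (∀ n, |q' n - q' (n + 1)| ≤ δ) → (∀ n ∉ window L, q n = q' n ∧ (q n = 0 ∨ q n = 1)) →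
      (∀ n ∈ window L, |q' n - q n| ≤ 1 / L) → ∀ θ,
      twistDet (window L ×ˢ (Finset.univ : Finset (Fin m))) (projEntry T C f g θ) (sitePhase q) ≠ 0 ∧
      ‖twistDet (window L ×ˢ (Finset.univ : Finset (Fin m))) (projEntry T C f g θ) (sitePhase q')
        / twistDet (window L ×ˢ (Finset.univ : Finset (Fin m))) (projEntry T C f g θ) (sitePhase q)
        * Complex.exp (-(2 * Real.pi * Complex.I *
          pairing (fun n => q' n - q n) (siteTrace T C f g) θ)) - 1‖ ≤ η := by
  -- Here `3 * m` bounds the total variation of the phases: `L + 2` sites with `m` components, each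
  -- moved by at most `1 / L`, where `L ≥ 1`.
  obtain ⟨ε, hε0, hε1, hε2⟩ : ∃ ε : ℝ, 0 < ε ∧ ε ≤ 1 / 4 ∧
      Real.exp (6 * Real.pi * ε * (3 * m)) - 1 ≤ η := by
    have hc : Continuous fun ε : ℝ => Real.exp (6 * Real.pi * ε * (3 * m)) - 1 := by fun_prop
    have h1 : ∀ᶠ ε in 𝓝[>] (0 : ℝ), Real.exp (6 * Real.pi * ε * (3 * m)) - 1 < η :=
      nhdsWithin_le_nhds (hc.tendsto 0 (Iio_mem_nhds (by simpa using hη)))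
    have h2 : ∀ᶠ ε in 𝓝[>] (0 : ℝ), ε < 1 / 4 :=
      nhdsWithin_le_nhds (Iio_mem_nhds (by norm_num))
    obtain ⟨ε, ⟨h3, h4⟩, h5⟩ := ((h1.and h2).and self_mem_nhdsWithin).exists
    exact ⟨ε, h5, h4.le, h3.le⟩
  obtain ⟨δ, hδ0, hδ⟩ := exists_forall_almostCommutes (T := T) (C := C) hf hg hε0
  refine ⟨δ, hδ0, fun q q' L hL hq hq' hN hd θ => ?_⟩
  set N := window L with hNdef
  -- Interpolating between the two cutoffs keeps the slope at most `δ`, and off the window the value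
  -- stays `0` or `1`.
  have hac : ∀ s ∈ Icc (0 : ℝ) 1, AlmostCommutes (stdBasis m) (opFun g (schrodinger T C f θ))
      (N ×ˢ (Finset.univ : Finset (Fin m))) (fun i => Complex.exp (2 * Real.pi * Complex.I *
        (q i.1 + s * ((q' i.1 - q i.1 : ℝ) : ℂ)))) ε := fun s hs => by
    have h1 := hδ θ (fun n => q n + s * (q' n - q n)) N (hP θ) (fun n => ?_) (fun n hn => ?_)
    · simpa using h1
    · have e : q n + s * (q' n - q n) - (q (n + 1) + s * (q' (n + 1) - q (n + 1)))
          = (1 - s) * (q n - q (n + 1)) + s * (q' n - q' (n + 1)) := by ring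
      rw [e]
      refine (abs_add_le _ _).trans ?_
      rw [abs_mul, abs_mul, abs_of_nonneg hs.1, abs_of_nonneg (sub_nonneg.2 hs.2)]
      nlinarith [hq n, hq' n, hs.1, hs.2]
    · obtain ⟨h1, h2⟩ := hN n hn
      rcases h2 with h2 | h2
      · simp [← h1, h2]
      · simp [← h1, h2, Complex.exp_two_pi_mul_I]
  have hD : ∑ i ∈ N ×ˢ (Finset.univ : Finset (Fin m)), |q' i.1 - q i.1| ≤ 3 * m := by
    rw [Finset.sum_product]
    have hL' : (1 : ℝ) ≤ L := by exact_mod_cast hL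
    refine (Finset.sum_le_sum (g := fun _ => m * (1 / L : ℝ)) fun n hn => ?_).trans ?_
    · simp only [Finset.sum_const, Finset.card_univ, Fintype.card_fin, nsmul_eq_mul]
      exact mul_le_mul_of_nonneg_left (hd n hn) m.cast_nonneg
    · rw [Finset.sum_const, card_window, nsmul_eq_mul]
      push_cast
      rw [mul_one_div, mul_div_assoc', div_le_iff₀ (by linarith)]
      have : (0 : ℝ) ≤ m := m.cast_nonneg
      nlinarith
  refine ⟨?_, ?_⟩
  · have := twistDet_ne_zero orthonormal_stdBasis (hP θ) hε1 (hac 0 ⟨le_rfl, zero_le_one⟩)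
    simp only [Complex.ofReal_zero, zero_mul, add_zero] at this
    exact this
  · have h1 := twistDet_ratio orthonormal_stdBasis (hP θ) hε0.le hε1 hac hD
    have h2 := sum_projEntry (T := T) (C := C) (f := f) (g := g) (fun n => q' n - q n)
      (N := N) (fun n hn => by rw [(hN n hn).1, sub_self]) θ
    simp only [projEntry] at h2
    rw [h2] at h1
    refine le_trans (le_of_eq ?_) (h1.trans hε2)
    simp only [Complex.ofReal_sub, add_sub_cancel]
    rfl

end Main

/-- If `g(H_θ)` is a projection for all `θ`, the mean of its local trace belongs to the
Schwartzman group. -/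
theorem integral_siteTrace_mem {Θ : Type*} [MetricSpace Θ] [CompactSpace Θ] [MeasurableSpace Θ]
    [BorelSpace Θ] {μ : Measure Θ} [IsProbabilityMeasure μ] {m : ℕ} {T : Θ ≃ₜ Θ}
    {C : Matrix (Fin m) (Fin m) ℂ} {f : C(Θ, Matrix (Fin m) (Fin m) ℂ)} {g : ℝ → ℝ}
    (hT : Ergodic T μ) (hf : ∀ θ, (f θ).IsHermitian) (hg : Continuous g)
    (hP : ∀ θ, IsProj (opFun g (schrodinger T C f θ))) :
    ∫ θ, siteTrace T C f g 0 θ ∂μ ∈ schwartzmanGroup T μ := by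
  set ρ := siteTrace T C f g
  have hρ : ∀ n, Continuous (ρ n) := continuous_siteTrace hf hg
  have hρT : ∀ n θ, ρ n (T θ) = ρ (n + 1) θ := siteTrace_apply_T hf hg
  have hint : ∀ n : ℤ, ∫ θ, ρ n θ ∂μ = ∫ θ, ρ 0 θ ∂μ := by
    have hstep : ∀ n : ℤ, ∫ θ, ρ (n + 1) θ ∂μ = ∫ θ, ρ n θ ∂μ := fun n => by
      simp only [← hρT]
      exact hT.toMeasurePreserving.integral_comp T.measurableEmbedding _
    intro n
    induction n using Int.induction_on with
    | zero => rfl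
    | succ n ih => rw [hstep, ih]
    | pred n ih => rw [← ih, ← hstep (-n - 1), sub_add_cancel]
  have hA0 : ∀ (L : ℕ) (n : ℤ), n ∉ window (L + 1) →
      cutoff (L + 1) (n - 1) - cutoff (L + 1) n = 0 := fun L n hn => by
    rcases notMem_window hn with h | h
    · rw [cutoff_of_nonpos _ (by omega), cutoff_of_nonpos _ (by omega), sub_self]
    · push_cast at h
      rw [cutoff_of_le (by omega) (by push_cast; omega),
        cutoff_of_le (by omega) (by push_cast; omega), sub_self]
  have hq : ∀ (L : ℕ) (n : ℤ), n ∉ window (L + 1) → cutoff (L + 1) n = cutoff (L + 2) n ∧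
      (cutoff (L + 1) n = 0 ∨ cutoff (L + 1) n = 1) := fun L n hn => by
    rcases notMem_window hn with h | h
    · rw [cutoff_of_nonpos _ (by omega), cutoff_of_nonpos _ (by omega)]
      simp
    · push_cast at h
      rw [cutoff_of_le (by omega) (by push_cast; omega),
        cutoff_of_le (by omega) (by push_cast; omega)]
      simp
  have hG0 : ∀ (L : ℕ) (n : ℤ), n ∉ window (L + 1) →
      cutoff (L + 2) n - cutoff (L + 1) n = 0 := fun L n hn => by
    rw [(hq L n hn).1, sub_self]
  -- Lengths start at `L + 1`, since `cutoff 0` involves division by zero and is identically `1`.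
  let A : ℕ → C(Θ, ℝ) := fun L =>
    ⟨pairing (fun n => cutoff (L + 1) (n - 1) - cutoff (L + 1) n) ρ,
      continuous_pairing (hA0 L) hρ⟩
  let G : ℕ → C(Θ, ℝ) := fun L =>
    ⟨pairing (fun n => cutoff (L + 2) n - cutoff (L + 1) n) ρ, continuous_pairing (hG0 L) hρ⟩
  refine mem_schwartzmanGroup_of_asymptotic hT (w := fun L => cutoffDet T C f g (L + 1)) (A := A)
    (G := G) (fun L θ => ?_) (fun η hη => ?_)
  · change pairing (fun n => cutoff (L + 2) n - cutoff (L + 1) n) ρ (T θ)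
      - pairing (fun n => cutoff (L + 2) n - cutoff (L + 1) n) ρ θ
      = pairing (fun n => cutoff (L + 2) (n - 1) - cutoff (L + 2) n) ρ θ
      - pairing (fun n => cutoff (L + 1) (n - 1) - cutoff (L + 1) n) ρ θ
    -- This window contains the supports of all four coefficient sequences, so the pairings can be
    -- subtracted termwise.
    have h1 : ∀ n, n ∉ window (L + 3) → n < 0 ∨ (L : ℤ) + 4 < n := fun n hn => by
      have := notMem_window hn
      push_cast at this
      omega
    have h3 : ∀ n ∉ window (L + 3), cutoff (L + 2) (n - 1) - cutoff (L + 1) (n - 1) = 0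
        ∧ cutoff (L + 2) n - cutoff (L + 1) n = 0
        ∧ cutoff (L + 2) (n - 1) - cutoff (L + 2) n = 0
        ∧ cutoff (L + 1) (n - 1) - cutoff (L + 1) n = 0 := fun n hn => by
      rcases h1 n hn with h | h
      · simp only [cutoff_of_nonpos _ (show n ≤ 0 by omega),
          cutoff_of_nonpos _ (show n - 1 ≤ 0 by omega)]
        simp
      · rw [cutoff_of_le (n := n) (L := L + 1) (by omega) (by push_cast; omega),
          cutoff_of_le (n := n - 1) (L := L + 1) (by omega) (by push_cast; omega),
          cutoff_of_le (n := n) (L := L + 2) (by omega) (by push_cast; omega),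
          cutoff_of_le (n := n - 1) (L := L + 2) (by omega) (by push_cast; omega)]
        simp
    rw [pairing_comp hρT, ← pairing_sub (N := window (L + 3)) (fun n hn => (h3 n hn).1)
      (fun n hn => (h3 n hn).2.1), ← pairing_sub (N := window (L + 3))
      (fun n hn => (h3 n hn).2.2.1) (fun n hn => (h3 n hn).2.2.2)]
    congr 1
    funext n
    ring
  · obtain ⟨δ, hδ0, hδ⟩ := exists_forall_twistDet_ratio (T := T) (C := C) hf hg hP hη
    obtain ⟨L₀, hL₀⟩ := exists_nat_one_div_lt hδ0
    refine ⟨L₀, fun L hL => ?_⟩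
    have hslow : ∀ K : ℕ, L + 1 ≤ K → ∀ n, |cutoff K n - cutoff K (n + 1)| ≤ δ := fun K hK n => by
      refine (abs_cutoff_sub_succ_le K n).trans (le_trans ?_ hL₀.le)
      refine one_div_le_one_div_of_le (by positivity) ?_
      have : L₀ + 1 ≤ K := by omega
      exact_mod_cast this
    -- The shifted cutoff accounts for `w ∘ T`, and the cutoff of the next length for `w (L + 1)`;
    -- both agree with the reference cutoff off the same window.
    have h1 := hδ (cutoff (L + 1)) (fun n => cutoff (L + 1) (n - 1)) (L + 1) (by omega)
      (hslow _ le_rfl) (fun n => by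
        have := hslow _ le_rfl (n - 1)
        simpa only [sub_add_cancel, add_sub_cancel_right] using this) (fun n hn => ⟨by linarith [hA0 L n hn], (hq L n hn).2⟩)
      (fun n _ => by
        have := abs_cutoff_sub_succ_le (L + 1) (n - 1)
        rwa [sub_add_cancel] at this)
    have h2 := hδ (cutoff (L + 1)) (cutoff (L + 2)) (L + 1) (by omega)
      (hslow _ le_rfl) (hslow _ (by omega)) (hq L)
      (fun n hn => by
        rw [window, Finset.mem_Icc] at hn
        exact abs_cutoff_succ_sub_le (by omega) hn.1 hn.2)
    refine ⟨continuous_twistDet _ (continuous_projEntry hf hg) _, fun θ => (h1 θ).1, ?_,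
      fun θ => ?_, fun θ => ?_⟩
    · have h3 : ∀ θ, A L θ = ∑ n ∈ window (L + 1),
          (cutoff (L + 1) (n - 1) - cutoff (L + 1) n) * ρ n θ := pairing_eq_sum (hA0 L) ρ
      simp only [h3]
      rw [integral_finsetSum _ fun n _ => ((hρ n).const_mul _).integrable_of_hasCompactSupport
        (HasCompactSupport.of_compactSpace _)]
      simp only [integral_const_mul, hint]
      -- All `ρ n` have the same mean, and the coefficients telescope to `1 - 0`.
      rw [← Finset.sum_mul, sum_window_sub, cutoff_of_nonpos _ (by norm_num),
        cutoff_of_le (by omega) (by omega), sub_zero, one_mul]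
    · rw [← cutoffDet_apply_T hf hg (by omega)]
      exact (h1 θ).2
    · have h3 : cutoffDet T C f g (L + 2) θ
          = twistDet (window (L + 1) ×ˢ (Finset.univ : Finset (Fin m))) (projEntry T C f g θ)
            (sitePhase (cutoff (L + 2))) := by
        refine (cutoffDet_eq (by omega) (fun n hn => ?_) θ).symm
        rw [Finset.mem_Icc] at hn
        rw [window, Finset.mem_Icc]
        push_cast at hn ⊢
        omega
      rw [h3]
      exact (h2 θ).2

end GapLabel

end

theorem theorem1 {Θ : Type*} [MetricSpace Θ] [CompactSpace Θ] [MeasurableSpace Θ] [BorelSpace Θ]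
    (μ : MeasureTheory.Measure Θ) [MeasureTheory.IsProbabilityMeasure μ]
    (T : Θ ≃ₜ Θ) (hT : Ergodic T μ) (hμ : μ.support = Set.univ)
    {m : ℕ} (hm : 0 < m) (C : GL (Fin m) ℂ)
    (f : C(Θ, Matrix (Fin m) (Fin m) ℂ)) (hf : ∀ θ, (f θ).IsHermitian) :
    (∃ S : Set ℝ, GapLabel.IsAlmostSureSpectrum μ T (C : Matrix (Fin m) (Fin m) ℂ) f S) ∧
    ∀ S : Set ℝ, GapLabel.IsAlmostSureSpectrum μ T (C : Matrix (Fin m) (Fin m) ℂ) f S →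
      ∀ E : ℝ, E ∉ S →
        (m : ℝ) * GapLabel.ids μ T (C : Matrix (Fin m) (Fin m) ℂ) f E ∈
          (GapLabel.schwartzmanGroup T μ : Set ℝ) ∩ Set.Icc (0 : ℝ) (m : ℝ) := by
  refine ⟨GapLabel.exists_isAlmostSureSpectrum hT hf, fun S hS E hE =>
    ⟨?_, GapLabel.mul_ids_mem_Icc hm hf E⟩⟩
  obtain ⟨r, hr, hgap⟩ := GapLabel.exists_forall_gap hμ hf hS hE
  -- A ramp equal to `1` up to `E - r` and to `0` from `E + r` on; it differs from the indicator of
  -- `(-∞, E]` only inside the gap.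
  set g : ℝ → ℝ := fun x => max 0 (min 1 (1 / 2 + (E - x) / (2 * r))) with hg
  have hgc : Continuous g := by fun_prop
  have hleft : ∀ x, r ≤ |x - E| → x ≤ E → g x = 1 := fun x h1 h2 => by
    rw [abs_of_nonpos (by linarith)] at h1
    have h3 : 1 / 2 ≤ (E - x) / (2 * r) := by
      rw [le_div_iff₀ (by positivity)]
      linarith
    rw [hg]
    dsimp only
    rw [min_eq_left (by linarith)]
    simp
  have hright : ∀ x, r ≤ |x - E| → ¬ x ≤ E → g x = 0 := fun x h1 h2 => by
    rw [abs_of_pos (by linarith)] at h1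
    have h3 : (E - x) / (2 * r) ≤ -(1 / 2) := by
      rw [div_le_iff₀ (by positivity)]
      linarith
    rw [hg]
    dsimp only
    rw [min_eq_right (by linarith), max_eq_left (by linarith)]
  have hP : ∀ θ, GapLabel.IsProj (GapLabel.opFun g (GapLabel.schrodinger T C f θ)) := fun θ => by
    refine GapLabel.isProj_cfc hgc (fun x hx => ?_) (GapLabel.isSelfAdjoint_schrodinger hf θ)
    by_cases h : x ≤ E
    · exact Or.inr (hleft x (hgap θ x hx) h)
    · exact Or.inl (hright x (hgap θ x hx) h)
  rw [GapLabel.mul_ids_eq_integral_entry hm hf hgc fun θ x hx => ?_]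
  · exact GapLabel.integral_siteTrace_mem hT hf hgc hP
  · by_cases h : x ≤ E
    · rw [hleft x (hgap θ x hx) h, Set.indicator_of_mem (Set.mem_Iic.2 h), Pi.one_apply]
    · rw [hright x (hgap θ x hx) h, Set.indicator_of_notMem (by simpa using h)]
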